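/- Let $M$ be a smooth manifold (finite-dimensional, without boundary, Hausdorff, second countable) with a smooth involution $\tau\colon M\to M$. For a sheaf $\mathcal S$ of abelian groups on $M$ with an action of $\mathbb Z_2$ covering the action on $M$ defined by $\tau$, let $H^p(M;\mathbb Z_2,\mathcal S)$ be the $p$-th right derived functor, applied to $\mathcal S$, of the functor of $\mathbb Z_2$-invariant global sections. Let $\mathcal U(1)$ be the sheaf of smooth $U(1)$-valued functions on $M$ with the action $f\mapsto f\circ\tau$, and $\overline{\mathcal U(1)}$ the same sheaf with the action $f\mapsto \bar f\circ\tau$. A Real (resp. equivariant) line bundle on $M$ is a smooth complex line bundle $L\to M$ with a smooth map $\tau_L\colon L\to L$ covering $\tau$ that is fibrewise complex antilinear (resp. complex linear) and satisfies $\tau_L^2=1$; isomorphisms are isomorphisms of smooth complex line bundles over $\mathrm{id}_M$ that commute with the lifts $\tau_L$. Then isomorphism classes of Real line bundles on $M$ are classified by $H^1(M;\mathbb Z_2,\overline{\mathcal U(1)})$, and isomorphism classes of equivariant line bundles on $M$ are classified by $H^1(M;\mathbb Z_2,\mathcal U(1))$. In each case there is a bijection from isomorphism classes to the cohomology group, and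 it sends $L$ to the class of its transition functions: if $\{U_\alpha\}$ is an open cover of $M$ whose index set has a fixed point free involution $\alpha\mapsto\bar\alpha$ with $\tau(U_\alpha)=U_{\bar\alpha}$, and $s_\alpha$ are smooth nowhere zero sections of $L$ over $U_\alpha$ with $s_{\bar\alpha}=\tau_L\circ s_\alpha\circ\tau$ and $s_\alpha=s_\beta\, g_{\alpha\beta}$ for smooth functions $g_{\alpha\beta}\colon U_\alpha\cap U_\beta\to U(1)$, then $L$ is sent to the image in $H^1$ of the invariant Čech cocycle $(g_{\alpha\beta})$; such $\{U_\alpha\}$ and $s_\alpha$ exist for every $L$. Here the image in $H^1(M;\mathbb Z_2,\mathcal S)$ of an invariant Čech cocycle $g$ is the class of $z$, where $0\to\mathcal S\to I^0\to I^1\to\cdots$ is an injective resolution by $\mathbb Z_2$-sheaves, $c_\alpha\in I^0(U_\alpha)$ is an invariant $0$-cochain with $c_\beta-c_\alpha=g_{\alpha\beta}$ on $U_\alpha\cap U_\beta$ (with $\mathcal S$ written additively), and $z$ is the invariant global section of $I^1$ with $z=dc_\alpha$ on $U_\alpha$. -/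

import Mathlib

open CategoryTheory TopologicalSpace Opposite
open scoped Manifold ContDiff Bundle

universe u v

noncomputable section

namespace RealLine

/-! ### Manifolds with involution -/

/-- A smooth involution on a manifold `M`. The pair `(M, τ)` is a Real manifold. -/
structure SmoothInvolution {E : Type*} [NormedAddCommGroup E] [NormedSpace ℝ E]
    {H : Type*} [TopologicalSpace H] (I : ModelWithCorners ℝ E H)
    (M : Type u) [TopologicalSpace M] [ChartedSpace H M] where
  toFun : M → M
  contMDiff_toFun : ContMDiff I I ∞ toFun
  involutive : Function.Involutive toFun

/-- The two kinds of lifts of an involution to a complex line bundle. -/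
inductive LiftKind : Type
  | linear
  | antilinear

namespace LiftKind

/-- The ring endomorphism of `ℂ` over which a lift is semilinear: the identity or conjugation. -/
def onComplex : LiftKind → (ℂ →+* ℂ)
  | linear => RingHom.id ℂ
  | antilinear => starRingEnd ℂ

/-- The induced automorphism of `U(1)`: the identity or conjugation `z ↦ z̄ = z⁻¹`. -/
def onCircle : LiftKind → (Circle →* Circle)
  | linear => MonoidHom.id Circle
  | antilinear => invMonoidHom

lemma coe_onCircle (κ : LiftKind) (z : Circle) :
    ((κ.onCircle z : Circle) : ℂ) = κ.onComplex (z : ℂ) := by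
  cases κ
  · rfl
  · exact Circle.coe_inv_eq_conj z

lemma contMDiff_onCircle (κ : LiftKind) : ContMDiff (𝓡 1) (𝓡 1) ∞ κ.onCircle := by
  cases κ
  · exact contMDiff_id
  · exact contMDiff_inv (𝓡 1) ∞

/-- The action of `ℤ/2` on `U(1)`, through `onCircle`. -/
def circleAct (κ : LiftKind) (a : ZMod 2) : Circle →* Circle :=
  if a = 0 then MonoidHom.id Circle else κ.onCircle

lemma circleAct_zero (κ : LiftKind) : κ.circleAct 0 = MonoidHom.id Circle := rfl

lemma circleAct_add (κ : LiftKind) (a b : ZMod 2) (z : Circle) :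
    κ.circleAct (a + b) z = κ.circleAct a (κ.circleAct b z) := by
  have h : ∀ w, κ.onCircle (κ.onCircle w) = w := by
    intro w
    cases κ
    · rfl
    · exact inv_inv w
  have h2 : (1 + 1 : ZMod 2) = 0 := rfl
  have h3 : ∀ c : ZMod 2, c = 0 ∨ c = 1 := by decide
  rcases h3 a with rfl | rfl <;> rcases h3 b with rfl | rfl <;> simp [circleAct, h, h2]

lemma contMDiff_circleAct (κ : LiftKind) (a : ZMod 2) :
    ContMDiff (𝓡 1) (𝓡 1) ∞ (κ.circleAct a) := by
  unfold circleAct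
  split_ifs
  · exact contMDiff_id
  · exact κ.contMDiff_onCircle

end LiftKind

section Site

variable {E : Type*} [NormedAddCommGroup E] [NormedSpace ℝ E]
  {H : Type*} [TopologicalSpace H] {I : ModelWithCorners ℝ E H}
  {M : Type u} [TopologicalSpace M] [ChartedSpace H M]

namespace SmoothInvolution

instance : CoeFun (SmoothInvolution I M) (fun _ => M → M) := ⟨toFun⟩

/-- The action of `ℤ/2` on `M` defined by the involution. -/
def act (τ : SmoothInvolution I M) (a : ZMod 2) : M → M :=
  if a = 0 then id else τ

lemma act_zero (τ : SmoothInvolution I M) (x : M) : τ.act 0 x = x := rfl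

lemma act_one (τ : SmoothInvolution I M) (x : M) : τ.act 1 x = τ x := rfl

lemma act_add (τ : SmoothInvolution I M) (a b : ZMod 2) (x : M) :
    τ.act (a + b) x = τ.act a (τ.act b x) := by
  have h : ∀ y, τ (τ y) = y := τ.involutive
  have h2 : (1 + 1 : ZMod 2) = 0 := rfl
  have h3 : ∀ c : ZMod 2, c = 0 ∨ c = 1 := by decide
  rcases h3 a with rfl | rfl <;> rcases h3 b with rfl | rfl <;> simp [act, h, h2]

lemma contMDiff_act (τ : SmoothInvolution I M) (a : ZMod 2) : ContMDiff I I ∞ (τ.act a) := by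
  unfold act
  split_ifs
  · exact contMDiff_id
  · exact τ.contMDiff_toFun

lemma act_act (τ : SmoothInvolution I M) (a : ZMod 2) (x : M) : τ.act a (τ.act a x) = x := by
  rw [← act_add, CharTwo.add_self_eq_zero, act_zero]

end SmoothInvolution

/-! ### `ℤ/2`-sheaves

A sheaf on `M` with an action of `ℤ/2` covering the action on `M` is the same thing as a sheaf on
the following site. The objects are the open subsets of `M`; a morphism `U ⟶ V` is an `a ∈ ℤ/2`
with `a U ⊆ V`; a sieve on `U` covers if the images of its members cover `U`. A presheaf `F` on
this category consists of groups `F(U)`, of restriction maps `F(V) → F(U)` for `U ⊆ V` (the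
morphisms with `a = 0`), which form a presheaf on `M`, and of isomorphisms `F(τ U) → F(U)` (the
morphisms with `a = 1` from `U` to `τ U`) that commute with the restriction maps and are inverse to
one another, i.e. of an involution of the presheaf covering `τ`. It is a sheaf for the topology
below if and only if the underlying presheaf on `M` is a sheaf. -/

/-- The open subsets of `M`, as objects of the site of `ℤ/2`-sheaves on `(M, τ)`. -/
structure ActionOpens (τ : SmoothInvolution I M) : Type u where
  carrier : Opens M

namespace ActionOpens

variable {τ : SmoothInvolution I M}

/-- A morphism `U ⟶ V` is an element `a` of `ℤ/2` with `a U ⊆ V`. -/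
@[ext]
structure Hom (U V : ActionOpens τ) : Type u where
  elt : ZMod 2
  maps : ∀ x ∈ U.carrier, τ.act elt x ∈ V.carrier

instance : SmallCategory (ActionOpens τ) where
  Hom := Hom
  id U := ⟨0, fun _ hx => hx⟩
  comp f g := ⟨g.elt + f.elt, fun x hx => by
    rw [SmoothInvolution.act_add]
    exact g.maps _ (f.maps x hx)⟩
  id_comp f := Hom.ext (add_zero _)
  comp_id f := Hom.ext (zero_add _)
  assoc f g h := Hom.ext (add_assoc _ _ _).symm

lemma id_elt (U : ActionOpens τ) : Hom.elt (𝟙 U) = 0 := rfl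

lemma comp_elt {U V W : ActionOpens τ} (f : U ⟶ V) (g : V ⟶ W) :
    Hom.elt (f ≫ g) = Hom.elt g + Hom.elt f := rfl

/-- The inclusion `U ⊆ V` as a morphism. -/
def incl {U V : ActionOpens τ} (h : ∀ x ∈ U.carrier, x ∈ V.carrier) : U ⟶ V :=
  Hom.mk 0 h

/-- The involution `τ : U → V`, if `τ U ⊆ V`, as a morphism. -/
def flip {U V : ActionOpens τ} (h : ∀ x ∈ U.carrier, τ x ∈ V.carrier) : U ⟶ V :=
  Hom.mk 1 h

/-- The whole manifold. -/
def whole (τ : SmoothInvolution I M) : ActionOpens τ := ⟨⊤⟩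

/-- A sieve on `U` covers if every point of `U` lies in the image of one of its members. -/
def topology (τ : SmoothInvolution I M) : GrothendieckTopology (ActionOpens τ) where
  sieves U := {S | ∀ x ∈ U.carrier, ∃ (V : ActionOpens τ) (f : V ⟶ U), S.arrows f ∧
    ∃ y ∈ V.carrier, τ.act f.elt y = x}
  top_mem' U x hx := ⟨U, 𝟙 U, trivial, x, hx, rfl⟩
  pullback_stable' U V S f hS x hx := by
    obtain ⟨W, g, hg, y, hy, hyx⟩ := hS _ (f.maps x hx)
    let P : ActionOpens τ := ⟨⟨{z | z ∈ V.carrier ∧ τ.act (g.elt + f.elt) z ∈ W.carrier},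
      V.carrier.isOpen.inter (W.carrier.isOpen.preimage (τ.contMDiff_act _).continuous)⟩⟩
    let p : P ⟶ V := incl fun z hz => hz.1
    let q : P ⟶ W := Hom.mk (g.elt + f.elt) fun z hz => hz.2
    have hpq : p ≫ f = q ≫ g := by
      refine Hom.ext ?_
      change f.elt + 0 = g.elt + (g.elt + f.elt)
      rw [← add_assoc, CharTwo.add_self_eq_zero, add_zero, zero_add]
    refine ⟨P, p, ?_, x, ⟨hx, ?_⟩, rfl⟩
    · change S.arrows (p ≫ f)
      rw [hpq]
      exact S.downward_closed hg q
    · rw [SmoothInvolution.act_add, ← hyx, SmoothInvolution.act_act]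
      exact hy
  transitive' U S hS R hR x hx := by
    obtain ⟨V, f, hf, y, hy, hyx⟩ := hS x hx
    obtain ⟨W, g, hg, z, hz, hzy⟩ := hR hf y hy
    refine ⟨W, g ≫ f, hg, z, hz, ?_⟩
    rw [comp_elt, SmoothInvolution.act_add, hzy, hyx]

end ActionOpens

/-- Sheaves of abelian groups on `M` with an action of `ℤ/2` covering the action on `M`. -/
abbrev Z2Sheaf (τ : SmoothInvolution I M) :=
  Sheaf (ActionOpens.topology τ) AddCommGrpCat.{u}

/-- The functor of invariant global sections of `ℤ/2`-sheaves. -/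
def invariantSections (τ : SmoothInvolution I M) : Z2Sheaf τ ⥤ AddCommGrpCat.{u} where
  obj F := AddCommGrpCat.of
    (AddMonoidHom.eqLocus
      (F.obj.map (ActionOpens.flip (U := ActionOpens.whole τ) (V := ActionOpens.whole τ)
        fun _ _ => trivial).op).hom
      (AddMonoidHom.id _))
  map {F G} φ := AddCommGrpCat.ofHom
    (((φ.hom.app (op (ActionOpens.whole τ))).hom.comp (AddSubgroup.subtype _)).codRestrict _
      (fun s => by
        have h := ConcreteCategory.congr_hom (φ.hom.naturality
          (ActionOpens.flip (U := ActionOpens.whole τ) (V := ActionOpens.whole τ)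
            fun _ _ => trivial).op) s.1
        refine h.symm.trans ?_
        exact congrArg (φ.hom.app (op (ActionOpens.whole τ))).hom s.2))
  map_id F := by ext; rfl
  map_comp f g := by ext; rfl

instance (τ : SmoothInvolution I M) : (invariantSections τ).Additive where
  map_add {F G f g} := by ext; rfl

/-- Equivariant sheaf cohomology `H^p(M; ℤ/2, F)`: the right derived functors of the functor of
invariant sections. -/
def equivariantCohomology (τ : SmoothInvolution I M) (p : ℕ) (F : Z2Sheaf τ) : AddCommGrpCat.{u} :=
  ((invariantSections τ).rightDerived p).obj F


/-! ### The sheaf of `U(1)`-valued functions -/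

/-- The smooth functions `U → U(1)`. -/
abbrev CircleFunctions (τ : SmoothInvolution I M) (U : ActionOpens τ) : Type u :=
  ContMDiffMap I (𝓡 1) U.carrier Circle ∞

/-- The pullback of `U(1)`-valued functions along the morphism of `U` to `V` given by `a ∈ ℤ/2`:
`f ↦ (x ↦ a · f (a x))`. For `a = 0` it is the restriction; for `a = 1` it is `f ↦ f ∘ τ` or
`f ↦ conj f ∘ τ`. -/
def circlePullback (κ : LiftKind) {τ : SmoothInvolution I M} {U V : ActionOpens τ} (φ : U ⟶ V) :
    CircleFunctions τ V →* CircleFunctions τ U where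
  toFun f := ⟨fun x => κ.circleAct φ.elt (f ⟨τ.act φ.elt x, φ.maps x x.2⟩), by
    refine (κ.contMDiff_circleAct _).comp (f.contMDiff.comp ?_)
    intro x
    rw [← ContMDiffAt.subtypeVal_comp_iff]
    exact ((τ.contMDiff_act φ.elt).comp contMDiff_subtype_val) x⟩
  map_one' := by
    ext x
    exact congrArg _ (map_one (κ.circleAct φ.elt))
  map_mul' f g := by
    ext x
    exact congrArg _ (map_mul (κ.circleAct φ.elt) _ _)

lemma circlePullback_apply (κ : LiftKind) {τ : SmoothInvolution I M} {U V : ActionOpens τ}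
    (φ : U ⟶ V) (f : CircleFunctions τ V) (x : U.carrier) :
    circlePullback κ φ f x = κ.circleAct φ.elt (f ⟨τ.act φ.elt x, φ.maps x x.2⟩) := rfl

lemma circlePullback_id (κ : LiftKind) {τ : SmoothInvolution I M} (U : ActionOpens τ)
    (f : CircleFunctions τ U) : circlePullback κ (𝟙 U) f = f := by
  ext x
  rfl

lemma circlePullback_comp (κ : LiftKind) {τ : SmoothInvolution I M} {U V W : ActionOpens τ}
    (φ : U ⟶ V) (ψ : V ⟶ W) (f : CircleFunctions τ W) :
    circlePullback κ (φ ≫ ψ) f = circlePullback κ φ (circlePullback κ ψ f) := by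
  refine ContMDiffMap.ext fun x => ?_
  simp only [circlePullback_apply, ← LiftKind.circleAct_add, ← SmoothInvolution.act_add,
    ActionOpens.comp_elt, add_comm φ.elt ψ.elt]

/-- The presheaf of smooth `U(1)`-valued functions with the action of `ℤ/2`. -/
def circlePresheaf (κ : LiftKind) (τ : SmoothInvolution I M) :
    (ActionOpens τ)ᵒᵖ ⥤ AddCommGrpCat.{u} where
  obj U := AddCommGrpCat.of (Additive (CircleFunctions τ U.unop))
  map φ := AddCommGrpCat.ofHom (MonoidHom.toAdditive (circlePullback κ φ.unop))
  map_id U := by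
    refine AddCommGrpCat.hom_ext (AddMonoidHom.ext fun f => ?_)
    exact congrArg Additive.ofMul (circlePullback_id κ U.unop (Additive.toMul f))
  map_comp φ ψ := by
    refine AddCommGrpCat.hom_ext (AddMonoidHom.ext fun f => ?_)
    exact congrArg Additive.ofMul (circlePullback_comp κ ψ.unop φ.unop (Additive.toMul f))

lemma circlePresheaf_isSheaf (κ : LiftKind) (τ : SmoothInvolution I M) :
    Presheaf.IsSheaf (ActionOpens.topology τ) (circlePresheaf κ τ) := by
  rw [Presheaf.isSheaf_iff_isSheaf_forget _ _ (forget AddCommGrpCat.{u}),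
    isSheaf_iff_isSheaf_of_type]
  intro U S hS x hx
  let r : ∀ {V : ActionOpens τ} (f : V ⟶ U), S.arrows f → CircleFunctions τ V :=
    fun f hf => Additive.toMul (x f hf)
  have inv : ∀ (a : ZMod 2) (z : Circle), κ.circleAct a (κ.circleAct a z) = z := fun a z => by
    rw [← LiftKind.circleAct_add, CharTwo.add_self_eq_zero, LiftKind.circleAct_zero]
    rfl
  -- the value at `f y` of the function to be constructed does not depend on `f` and `y`
  have key : ∀ {V W : ActionOpens τ} (f : V ⟶ U) (g : W ⟶ U) (hf : S.arrows f) (hg : S.arrows g)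
      (y : V.carrier) (z : W.carrier), τ.act f.elt y = τ.act g.elt z →
      κ.circleAct f.elt (r f hf y) = κ.circleAct g.elt (r g hg z) := by
    intro V W f g hf hg y z hyz
    let P : ActionOpens τ := ⟨⟨{q | q ∈ V.carrier ∧ τ.act (g.elt + f.elt) q ∈ W.carrier},
      V.carrier.isOpen.inter (W.carrier.isOpen.preimage (τ.contMDiff_act _).continuous)⟩⟩
    let p : P ⟶ V := ActionOpens.incl fun q hq => hq.1
    let q : P ⟶ W := ActionOpens.Hom.mk (g.elt + f.elt) fun q hq => hq.2
    have hpq : p ≫ f = q ≫ g := by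
      refine ActionOpens.Hom.ext ?_
      change f.elt + 0 = g.elt + (g.elt + f.elt)
      rw [← add_assoc, CharTwo.add_self_eq_zero, add_zero, zero_add]
    have hz : τ.act (g.elt + f.elt) y = z := by
      rw [SmoothInvolution.act_add, hyz, SmoothInvolution.act_act]
    have hc : circlePullback κ p (r f hf) = circlePullback κ q (r g hg) :=
      congrArg Additive.toMul (hx p q hf hg hpq)
    have hy : (y : M) ∈ P.carrier := ⟨y.2, by rw [hz]; exact z.2⟩
    have h1 := congrArg (fun F : CircleFunctions τ P => F ⟨y, hy⟩) hc
    have h2 : r f hf y = κ.circleAct (g.elt + f.elt) (r g hg z) := by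
      refine h1.trans ?_
      exact congrArg (fun w => κ.circleAct (g.elt + f.elt) (r g hg w)) (Subtype.ext hz)
    rw [h2, ← LiftKind.circleAct_add, add_comm g.elt, ← add_assoc, CharTwo.add_self_eq_zero,
      zero_add]
  choose V f hf y hy hyx using hS
  let t : U.carrier → Circle := fun p =>
    κ.circleAct (f p p.2).elt (r (f p p.2) (hf p p.2) ⟨y p p.2, hy p p.2⟩)
  have ht : ∀ {W : ActionOpens τ} (g : W ⟶ U) (hg : S.arrows g) (z : W.carrier) (p : U.carrier),
      τ.act g.elt z = p → t p = κ.circleAct g.elt (r g hg z) := by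
    intro W g hg z p hzp
    exact key _ _ _ _ _ _ ((hyx p p.2).trans hzp.symm)
  have hsmooth : ContMDiff I (𝓡 1) ∞ t := by
    intro p
    let g := f p p.2
    let hg := hf p p.2
    classical
    let F : M → Circle := fun w => if h : w ∈ (V p p.2).carrier then r g hg ⟨w, h⟩ else 1
    have hF : ContMDiffAt I (𝓡 1) ∞ F (y p p.2) := by
      rw [← contMDiffAt_subtype_iff (x := (⟨y p p.2, hy p p.2⟩ : (V p p.2).carrier))]
      refine ((r g hg).contMDiff _).congr_of_eventuallyEq (Filter.Eventually.of_forall ?_)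
      intro w
      exact dif_pos w.2
    have hact : τ.act g.elt (p : M) = y p p.2 := by
      exact (congrArg (τ.act g.elt) (hyx p p.2)).symm.trans (SmoothInvolution.act_act _ _ _)
    have hcomp : ContMDiffAt I (𝓡 1) ∞
        (fun q : U.carrier => κ.circleAct g.elt (F (τ.act g.elt (q : M)))) p := by
      refine (κ.contMDiff_circleAct g.elt _).comp p ?_
      refine ContMDiffAt.comp (g := F) p ?_ (((τ.contMDiff_act g.elt).comp contMDiff_subtype_val) p)
      rw [hact]
      exact hF
    refine hcomp.congr_of_eventuallyEq ?_
    have hopen : IsOpen {q : U.carrier | τ.act g.elt (q : M) ∈ (V p p.2).carrier} :=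
      (V p p.2).carrier.isOpen.preimage
        ((τ.contMDiff_act g.elt).continuous.comp continuous_subtype_val)
    filter_upwards [hopen.mem_nhds (show τ.act g.elt (p : M) ∈ (V p p.2).carrier by
      rw [hact]; exact hy p p.2)] with q hq
    rw [ht g hg ⟨_, hq⟩ q (SmoothInvolution.act_act _ _ _)]
    have hFq : F (τ.act g.elt (q : M)) = r g hg ⟨_, hq⟩ := dif_pos hq
    rw [hFq]
  let T : CircleFunctions τ U := ⟨t, hsmooth⟩
  refine ⟨Additive.ofMul T, ?_, ?_⟩
  · intro W g hg
    refine congrArg Additive.ofMul (ContMDiffMap.ext fun z => ?_ :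
      circlePullback κ g T = r g hg)
    rw [circlePullback_apply]
    refine (congrArg _ (ht g hg z ⟨_, g.maps z z.2⟩ rfl)).trans (inv _ _)
  · intro t' ht'
    refine congrArg Additive.ofMul (ContMDiffMap.ext fun p => ?_ :
      (Additive.toMul t' : CircleFunctions τ U) = T)
    have h1 : circlePullback κ (f p p.2) (Additive.toMul t') = r (f p p.2) (hf p p.2) :=
      congrArg Additive.toMul (ht' (f p p.2) (hf p p.2))
    have h2 := congrArg (fun F : CircleFunctions τ _ => F ⟨y p p.2, hy p p.2⟩) h1
    change (Additive.toMul t' : CircleFunctions τ U) p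
      = κ.circleAct _ (r (f p p.2) (hf p p.2) ⟨y p p.2, hy p p.2⟩)
    rw [← h2]
    simp only [circlePullback_apply, inv]
    exact congrArg _ (Subtype.ext (hyx p p.2).symm)

/-- The `ℤ/2`-sheaf of smooth functions with values in `U(1)`. For `linear` this is the sheaf
`𝒰(1)` with the action `f ↦ f ∘ τ`, for `antilinear` it is the sheaf `𝒰(1)` with the conjugation
action `f ↦ conj f ∘ τ`. -/
def circleSheaf (κ : LiftKind) (τ : SmoothInvolution I M) : Z2Sheaf τ :=
  ⟨circlePresheaf κ τ, circlePresheaf_isSheaf κ τ⟩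

/-! ### Čech cocycles -/

/-- An open cover of `M`, whose index set carries an involution without fixed points, written
`bar`, such that `τ (U α) = U (bar α)`. -/
structure RealCover (τ : SmoothInvolution I M) where
  Index : Type u
  bar : Index → Index
  bar_involutive : Function.Involutive bar
  bar_ne : ∀ α, bar α ≠ α
  set : Index → Opens M
  covers : ∀ x, ∃ α, x ∈ set α
  map_mem : ∀ α, ∀ x ∈ set α, τ x ∈ set (bar α)

namespace RealCover

variable {τ : SmoothInvolution I M} (𝒰 : RealCover τ)

/-- The open set `U α`. -/
def single (α : 𝒰.Index) : ActionOpens τ := ⟨𝒰.set α⟩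

/-- The open set `U α ∩ U β`. -/
def double (α β : 𝒰.Index) : ActionOpens τ := ⟨𝒰.set α ⊓ 𝒰.set β⟩

/-- The inclusion of `U α ∩ U β` in `U α`. -/
def fst (α β : 𝒰.Index) : 𝒰.double α β ⟶ 𝒰.single α := ActionOpens.incl fun _ hx => hx.1

/-- The inclusion of `U α ∩ U β` in `U β`. -/
def snd (α β : 𝒰.Index) : 𝒰.double α β ⟶ 𝒰.single β := ActionOpens.incl fun _ hx => hx.2

/-- The inclusion of `U α` in `M`. -/
def toWhole (α : 𝒰.Index) : 𝒰.single α ⟶ ActionOpens.whole τ := ActionOpens.incl fun _ _ => trivial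

/-- The involution from `U α` to `U (bar α)`. -/
def flip (α : 𝒰.Index) : 𝒰.single α ⟶ 𝒰.single (𝒰.bar α) :=
  ActionOpens.flip (𝒰.map_mem α)

/-- A Čech `1`-cochain `g` with values in a `ℤ/2`-sheaf `F` represents the class `ξ` in
`H¹(M; ℤ/2, F)`. With an injective resolution `0 → F → I⁰ → I¹ → ⋯`, this means that `g` is the Čech
coboundary of an invariant `0`-cochain `c` of `I⁰` (so that `g` is an invariant cocycle), and that
`ξ` is the class of the invariant section `z` of `I¹` which equals `d c_α` on `U α`. -/
def Represents {F : Z2Sheaf τ} (g : ∀ α β, F.obj.obj (op (𝒰.double α β)))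
    (ξ : equivariantCohomology τ 1 F) : Prop :=
  let R := injectiveResolution F
  let K := ((invariantSections τ).mapHomologicalComplex (ComplexShape.up ℕ)).obj R.cocomplex
  ∃ (c : ∀ α, (R.cocomplex.X 0).obj.obj (op (𝒰.single α))) (z : K.cycles 1),
    (∀ α β, (R.cocomplex.X 0).obj.map (𝒰.snd α β).op (c β)
      - (R.cocomplex.X 0).obj.map (𝒰.fst α β).op (c α)
      = (R.ι.f 0).hom.app (op (𝒰.double α β)) (g α β)) ∧
    (∀ α, (R.cocomplex.X 0).obj.map (𝒰.flip α).op (c (𝒰.bar α)) = c α) ∧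
    (∀ α, (R.cocomplex.X 1).obj.map (𝒰.toWhole α).op (K.iCycles 1 z).1
      = (R.cocomplex.d 0 1).hom.app (op (𝒰.single α)) (c α)) ∧
    ξ = (R.isoRightDerivedObj (invariantSections τ) 1).inv (K.homologyπ 1 z)

end RealCover

/-! ### Line bundles -/

variable (I M) in
/-- A smooth complex line bundle on `M`. -/
structure LineBundle where
  Fiber : M → Type v
  [topTotal : TopologicalSpace (Bundle.TotalSpace ℂ Fiber)]
  [topFiber : ∀ x, TopologicalSpace (Fiber x)]
  [addCommGroup : ∀ x, AddCommGroup (Fiber x)]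
  [module : ∀ x, Module ℂ (Fiber x)]
  [fiberBundle : FiberBundle ℂ Fiber]
  [complexBundle : VectorBundle ℂ ℂ Fiber]
  [realBundle : VectorBundle ℝ ℂ Fiber]
  [smooth : ContMDiffVectorBundle ∞ ℂ Fiber I]

attribute [instance] LineBundle.topTotal LineBundle.topFiber LineBundle.addCommGroup
  LineBundle.module LineBundle.fiberBundle LineBundle.complexBundle LineBundle.realBundle
  LineBundle.smooth

/-- A smooth complex line bundle `L` with a smooth lift of `τ` to an involution of `L` that is
fibrewise complex linear or antilinear. For `antilinear` this is a Real line bundle, for `linear`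
this is an equivariant line bundle. -/
structure LiftedLineBundle (κ : LiftKind) (τ : SmoothInvolution I M) extends LineBundle.{u, v} I M
    where
  lift : ∀ x, Fiber x →ₛₗ[κ.onComplex] Fiber (τ x)
  contMDiff_lift : ContMDiff (I.prod 𝓘(ℝ, ℂ)) (I.prod 𝓘(ℝ, ℂ)) ∞
    (fun p : Bundle.TotalSpace ℂ Fiber =>
      (⟨τ p.1, lift p.1 p.2⟩ : Bundle.TotalSpace ℂ Fiber))
  lift_lift : ∀ p : Bundle.TotalSpace ℂ Fiber,
    (⟨τ (τ p.1), lift (τ p.1) (lift p.1 p.2)⟩ : Bundle.TotalSpace ℂ Fiber) = p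

namespace LiftedLineBundle

variable {κ : LiftKind} {τ : SmoothInvolution I M}

/-- Two line bundles with lifts of `τ` are isomorphic if there is an isomorphism of smooth complex
line bundles over the identity of `M` that commutes with the lifts. -/
def Isomorphic (L L' : LiftedLineBundle.{u, v} κ τ) : Prop :=
  ∃ e : ∀ x, L.Fiber x ≃ₗ[ℂ] L'.Fiber x,
    ContMDiff (I.prod 𝓘(ℝ, ℂ)) (I.prod 𝓘(ℝ, ℂ)) ∞
      (fun p : Bundle.TotalSpace ℂ L.Fiber =>
        (⟨p.1, e p.1 p.2⟩ : Bundle.TotalSpace ℂ L'.Fiber)) ∧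
    ContMDiff (I.prod 𝓘(ℝ, ℂ)) (I.prod 𝓘(ℝ, ℂ)) ∞
      (fun p : Bundle.TotalSpace ℂ L'.Fiber =>
        (⟨p.1, (e p.1).symm p.2⟩ : Bundle.TotalSpace ℂ L.Fiber)) ∧
    ∀ x v, e (τ x) (L.lift x v) = L'.lift x (e x v)

/-- Isomorphism of line bundles with lifts of `τ`, as an equivalence relation. -/
instance isoSetoid (κ : LiftKind) (τ : SmoothInvolution I M) :
    Setoid (LiftedLineBundle.{u, v} κ τ) where
  r := Isomorphic
  iseqv :=
    { refl := fun L => ⟨fun _ => LinearEquiv.refl _ _, contMDiff_id, contMDiff_id,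
        fun _ _ => rfl⟩
      symm := by
        rintro L L' ⟨e, h, h', hc⟩
        refine ⟨fun x => (e x).symm, h', h, fun x v => ?_⟩
        rw [LinearEquiv.symm_apply_eq, hc, LinearEquiv.apply_symm_apply]
      trans := by
        rintro L L' L'' ⟨e, h, h', hc⟩ ⟨f, k, k', kc⟩
        exact ⟨fun x => (e x).trans (f x), k.comp h, h'.comp k', fun x v => by
          simp [hc, kc]⟩ }

/-- Isomorphism classes of line bundles with lifts of `τ`. -/
def IsoClasses (κ : LiftKind) (τ : SmoothInvolution I M) : Type (max u (v + 1)) :=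
  Quotient (isoSetoid.{u, v} (I := I) κ τ)

/-- `g` is a system of transition functions of `L` on the cover `𝒰`: there are smooth nowhere zero
sections `s_α` of `L` on `U α` such that `s_(bar α) = τ_L ∘ s_α ∘ τ` and `s_α = s_β g_αβ`, where
the `g_αβ` are smooth functions with values in `U(1)`. -/
def IsTransition (L : LiftedLineBundle.{u, v} κ τ) (𝒰 : RealCover τ)
    (g : ∀ α β, CircleFunctions τ (𝒰.double α β)) : Prop :=
  ∃ s : 𝒰.Index → ∀ x, L.Fiber x,
    (∀ α, ContMDiffOn I (I.prod 𝓘(ℝ, ℂ)) ∞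
      (fun x => (⟨x, s α x⟩ : Bundle.TotalSpace ℂ L.Fiber)) (𝒰.set α)) ∧
    (∀ α, ∀ x ∈ 𝒰.set α, s α x ≠ 0) ∧
    (∀ α, ∀ x ∈ 𝒰.set α, s (𝒰.bar α) (τ x) = L.lift x (s α x)) ∧
    (∀ α β, ∀ x : (𝒰.double α β).carrier, s α x = ((g α β x : Circle) : ℂ) • s β x)

/-- `ξ` is the class of `L` in `H¹(M; ℤ/2, 𝒰(1))`, where `ℤ/2` acts on `𝒰(1)` trivially
(`linear`) or by conjugation (`antilinear`): it is represented by a system of transition functions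
of `L`. -/
def HasClass (L : LiftedLineBundle.{u, v} κ τ)
    (ξ : equivariantCohomology τ 1 (circleSheaf κ τ)) : Prop :=
  ∃ (𝒰 : RealCover τ) (g : ∀ α β, CircleFunctions τ (𝒰.double α β)),
    L.IsTransition 𝒰 g ∧
      𝒰.Represents (F := circleSheaf κ τ) (fun α β => Additive.ofMul (g α β)) ξ

end LiftedLineBundle

end Site

end RealLine

end

/-! Both classifications have the same proof, in which `κ` only decides whether the nontrivial
element acts on scalars by the identity or by conjugation. Invariant Čech cocycles mediate between
derived functor cohomology and line bundles.

On the cohomological side, let `F → I⁰ → I¹` begin an injective resolution. An invariant cycle `z`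
of `I¹` has local primitives in `I⁰`. Transporting them by `τ` gives an invariant cochain `c` on a
Real cover, and the differences of `c` on overlaps come from `F`; so every class has a cocycle
(`RealCover.exists_represents`). Conversely, every invariant cocycle of `F` becomes a coboundary in
`I⁰` (`IsInvariantCocycle.exists_primitive`): it is tautologically a coboundary in the larger
presheaf of families of sections over small open sets, and `I⁰`, being injective even among
presheaves, receives a map from that presheaf extending `F → I⁰`. Two cocycles of one class, on
arbitrary covers, differ by an invariant cochain on the intersections of members of the two covers
(`Represents.exists_comparison`).

On the geometric side, a local frame and its transport by the lift form an invariant frame system;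
the free involution on indices means that no local frame has to be invariant by itself. An invariant
fibrewise norm, built from a partition of unity, makes the transition functions `U(1)`-valued. Two
frame systems normalised by the same norm combine into one on the disjoint union of the covers, so
the class is unique (`HasClass.unique`). The comparison cochain of two bundles with one class is an
isomorphism written in frames (`HasClass.isomorphic`). Gluing trivial bundles along an invariant
cocycle realises every class (`exists_hasClass_eq`). -/

namespace RealLine

/-! ### Gluing and injectivity for sheaves with an action -/

section SheafTheory

variable {E : Type*} [NormedAddCommGroup E] [NormedSpace ℝ E]
  {H : Type*} [TopologicalSpace H] {I : ModelWithCorners ℝ E H}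
  {M : Type u} [TopologicalSpace M] [ChartedSpace H M] {τ : SmoothInvolution I M}

namespace ActionOpens

lemma hom_ext {U V : ActionOpens τ} {p q : U ⟶ V} (h : Hom.elt p = Hom.elt q) : p = q :=
  Hom.ext h

lemma elt_eq_zero_or_one {U V : ActionOpens τ} (p : U ⟶ V) :
    Hom.elt p = 0 ∨ Hom.elt p = 1 := by
  have : ∀ a : ZMod 2, a = 0 ∨ a = 1 := by decide
  exact this _

lemma map_map_apply (G : (ActionOpens τ)ᵒᵖ ⥤ AddCommGrpCat.{u}) {U V W : ActionOpens τ}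
    (p : U ⟶ V) (q : V ⟶ W) (x : G.obj (op W)) :
    G.map p.op (G.map q.op x) = G.map (p ≫ q).op x := by
  rw [op_comp, G.map_comp]; rfl

lemma map_congr_apply (G : (ActionOpens τ)ᵒᵖ ⥤ AddCommGrpCat.{u}) {U V : ActionOpens τ}
    {p q : U ⟶ V} (h : Hom.elt p = Hom.elt q) (x : G.obj (op V)) :
    G.map p.op x = G.map q.op x := by
  rw [hom_ext h]

lemma generate_mem_topology {W : ActionOpens τ} {ι : Type*} (V : ι → ActionOpens τ)
    (f : ∀ i, V i ⟶ W) (hf : ∀ i, Hom.elt (f i) = 0)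
    (hcov : ∀ x ∈ W.carrier, ∃ i, x ∈ (V i).carrier) :
    Sieve.generate (Presieve.ofArrows V f) ∈ topology τ W := by
  intro x hx
  obtain ⟨i, hi⟩ := hcov x hx
  refine ⟨V i, f i, ⟨V i, 𝟙 _, f i, ⟨i⟩, Category.id_comp _⟩, x, hi, ?_⟩
  rw [hf i, SmoothInvolution.act_zero]

end ActionOpens

open ActionOpens

namespace Z2Sheaf

variable (G : Z2Sheaf τ)

lemma isSheafFor {W : ActionOpens τ} {ι : Type*} (V : ι → ActionOpens τ)
    (f : ∀ i, V i ⟶ W) (hf : ∀ i, Hom.elt (f i) = 0)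
    (hcov : ∀ x ∈ W.carrier, ∃ i, x ∈ (V i).carrier) :
    (Presieve.ofArrows V f).IsSheafFor (G.obj ⋙ forget AddCommGrpCat.{u}) := by
  have h := G.property
  rw [Presheaf.isSheaf_iff_isSheaf_forget _ _ (forget AddCommGrpCat.{u}),
    isSheaf_iff_isSheaf_of_type] at h
  rw [Presieve.isSheafFor_iff_generate]
  exact h _ (generate_mem_topology V f hf hcov)

/-- Sections of a `ℤ/2`-sheaf over a cover which agree on overlaps glue. -/
lemma exists_glue {W : ActionOpens τ} {ι : Type*} (V : ι → ActionOpens τ)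
    (f : ∀ i, V i ⟶ W) (hf : ∀ i, Hom.elt (f i) = 0)
    (hcov : ∀ x ∈ W.carrier, ∃ i, x ∈ (V i).carrier) (s : ∀ i, G.obj.obj (op (V i)))
    (hs : ∀ i j (Z : ActionOpens τ) (p : Z ⟶ V i) (q : Z ⟶ V j), Hom.elt p = Hom.elt q →
      G.obj.map p.op (s i) = G.obj.map q.op (s j)) :
    ∃ t : G.obj.obj (op W), ∀ i, G.obj.map (f i).op t = s i := by
  obtain ⟨t, ht, -⟩ := (Presieve.isSheafFor_arrows_iff _ _).1 (G.isSheafFor V f hf hcov) s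
    (fun i j Z p q h => hs i j Z p q (by
      have := congrArg Hom.elt h
      rwa [comp_elt, comp_elt, hf, hf, zero_add, zero_add] at this))
  exact ⟨t, ht⟩

/-- Sections of a `ℤ/2`-sheaf are determined by their restrictions to a cover. -/
lemma section_ext {W : ActionOpens τ} {ι : Type*} (V : ι → ActionOpens τ)
    (f : ∀ i, V i ⟶ W) (hf : ∀ i, Hom.elt (f i) = 0)
    (hcov : ∀ x ∈ W.carrier, ∃ i, x ∈ (V i).carrier) {s t : G.obj.obj (op W)}
    (h : ∀ i, G.obj.map (f i).op s = G.obj.map (f i).op t) : s = t := by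
  refine ((G.isSheafFor V f hf hcov).isSeparatedFor).ext ?_
  rintro Y g ⟨i⟩
  exact h i

lemma naturality_apply {G G' : Z2Sheaf τ} (φ : G ⟶ G') {U V : ActionOpens τ} (p : U ⟶ V)
    (x : G.obj.obj (op V)) :
    φ.hom.app (op U) (G.obj.map p.op x) = G'.obj.map p.op (φ.hom.app (op V) x) :=
  ConcreteCategory.congr_hom (φ.hom.naturality p.op) x

/-- An injective `ℤ/2`-sheaf is injective as a presheaf. -/
lemma injective_presheaf [Injective G] : Injective G.obj :=
  -- Sheafification preserves monomorphisms, so its right adjoint, the inclusion into presheaves,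
  -- preserves injectives.
  Injective.injective_of_adjoint
    (sheafificationAdjunction (ActionOpens.topology τ) AddCommGrpCat.{u}) G

end Z2Sheaf

end SheafTheory
-- Invariant Čech cocycles become coboundaries in injective sheaves
section Cech

variable {E : Type*} [NormedAddCommGroup E] [NormedSpace ℝ E]
  {H : Type*} [TopologicalSpace H] {I : ModelWithCorners ℝ E H}
  {M : Type u} [TopologicalSpace M] [ChartedSpace H M] {τ : SmoothInvolution I M}

open ActionOpens

namespace RealCover

variable (𝒰 : RealCover τ)

/-- The action of `ℤ/2` on the index set of a Real cover. -/
def barBy (a : ZMod 2) (α : 𝒰.Index) : 𝒰.Index := if a = 0 then α else 𝒰.bar α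

lemma barBy_add_one (a : ZMod 2) (α : 𝒰.Index) :
    𝒰.barBy (1 + a) α = 𝒰.bar (𝒰.barBy a α) := by
  have h : ∀ c : ZMod 2, c = 0 ∨ c = 1 := by decide
  rcases h a with rfl | rfl
  · rfl
  · exact (𝒰.bar_involutive α).symm

lemma act_mem_barBy (a : ZMod 2) (α : 𝒰.Index) {x : M} (hx : x ∈ 𝒰.set α) :
    τ.act a x ∈ 𝒰.set (𝒰.barBy a α) := by
  have h : ∀ c : ZMod 2, c = 0 ∨ c = 1 := by decide
  rcases h a with rfl | rfl
  · exact hx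
  · exact 𝒰.map_mem α x hx

variable {𝒰} in
/-- The morphism to an intersection defined by morphisms to its two members. -/
def lift {Z : ActionOpens τ} {α β : 𝒰.Index} (p : Z ⟶ 𝒰.single α) (q : Z ⟶ 𝒰.single β)
    (h : Hom.elt p = Hom.elt q) : Z ⟶ 𝒰.double α β :=
  Hom.mk (Hom.elt p) fun x hx => ⟨p.maps x hx, by rw [h]; exact q.maps x hx⟩

/-- The involution from `U α ∩ U β` to `U (bar α) ∩ U (bar β)`. -/
def doubleFlip (α β : 𝒰.Index) : 𝒰.double α β ⟶ 𝒰.double (𝒰.bar α) (𝒰.bar β) :=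
  ActionOpens.flip fun x hx => ⟨𝒰.map_mem α x hx.1, 𝒰.map_mem β x hx.2⟩

/-- Invariant Čech `1`-cocycles with values in a `ℤ/2`-sheaf. -/
structure IsInvariantCocycle {F : Z2Sheaf τ} (g : ∀ α β, F.obj.obj (op (𝒰.double α β))) :
    Prop where
  cocycle : ∀ (α β γ : 𝒰.Index) (Z : ActionOpens τ) (p : Z ⟶ 𝒰.double α β)
    (q : Z ⟶ 𝒰.double β γ) (r : Z ⟶ 𝒰.double α γ), Hom.elt p = Hom.elt q →
    Hom.elt q = Hom.elt r →
    F.obj.map p.op (g α β) + F.obj.map q.op (g β γ) = F.obj.map r.op (g α γ)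
  invariant : ∀ α β, F.obj.map (𝒰.doubleFlip α β).op (g (𝒰.bar α) (𝒰.bar β)) = g α β

/-- A morphism to `V` from an open subset of a member of the cover. -/
structure CoverArrow (V : ActionOpens τ) : Type u where
  idx : 𝒰.Index
  dom : ActionOpens τ
  mem : ∀ x ∈ dom.carrier, x ∈ 𝒰.set idx
  hom : dom ⟶ V

variable {𝒰} in
/-- Composition of a morphism from an open subset of a member of the cover with a morphism. -/
def CoverArrow.comp {V W : ActionOpens τ} (j : 𝒰.CoverArrow V) (φ : V ⟶ W) : 𝒰.CoverArrow W :=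
  ⟨j.idx, j.dom, j.mem, j.hom ≫ φ⟩

lemma coverArrow_congr {V : ActionOpens τ} (F : Z2Sheaf τ)
    (t : ∀ j : 𝒰.CoverArrow V, F.obj.obj (op j.dom)) (i : 𝒰.Index) (d : ActionOpens τ)
    (m : ∀ x ∈ d.carrier, x ∈ 𝒰.set i) {h h' : d ⟶ V} (hh : h = h') :
    t ⟨i, d, m, h⟩ = t ⟨i, d, m, h'⟩ := by
  subst hh; rfl

/-- The presheaf of families of sections of `F` over all open subsets of members of the cover. -/
def familyPresheaf (F : Z2Sheaf τ) : (ActionOpens τ)ᵒᵖ ⥤ AddCommGrpCat.{u} where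
  obj V := AddCommGrpCat.of (∀ j : 𝒰.CoverArrow V.unop, F.obj.obj (op j.dom))
  map {V W} φ := AddCommGrpCat.ofHom
    { toFun := fun t j => t (j.comp φ.unop)
      map_zero' := rfl
      map_add' := fun _ _ => rfl }
  map_id V := by
    refine AddCommGrpCat.hom_ext (AddMonoidHom.ext fun t => funext fun j => ?_)
    exact 𝒰.coverArrow_congr F t _ _ _ (Category.comp_id _)
  map_comp φ ψ := by
    refine AddCommGrpCat.hom_ext (AddMonoidHom.ext fun t => funext fun j => ?_)
    exact 𝒰.coverArrow_congr F t _ _ _ (Category.assoc _ _ _).symm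

/-- The map of `F` to the presheaf of families, given by the restrictions of a section. -/
def toFamilyPresheaf (F : Z2Sheaf τ) : F.obj ⟶ 𝒰.familyPresheaf F where
  app V := AddCommGrpCat.ofHom
    { toFun := fun s j => F.obj.map j.hom.op s
      map_zero' := funext fun j => map_zero _
      map_add' := fun _ _ => funext fun j => map_add _ _ _ }
  naturality V W φ := by
    refine AddCommGrpCat.hom_ext (AddMonoidHom.ext fun s => funext fun j => ?_)
    exact map_map_apply F.obj j.hom φ.unop s

/-- The family of a section over `V` contains its restrictions to all `V ∩ U α`. These cover `V`, so
the sheaf property of `F` recovers the section. -/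
instance mono_toFamilyPresheaf (F : Z2Sheaf τ) : Mono (𝒰.toFamilyPresheaf F) := by
  have : ∀ V, Mono ((𝒰.toFamilyPresheaf F).app V) := by
    intro V
    rw [AddCommGrpCat.mono_iff_injective]
    intro s t hst
    let W : 𝒰.Index → ActionOpens τ := fun α => ⟨V.unop.carrier ⊓ 𝒰.set α⟩
    let f : ∀ α, W α ⟶ V.unop := fun α => ActionOpens.incl fun x hx => hx.1
    refine F.section_ext W f (fun _ => rfl) (fun x hx => ?_) fun α => ?_
    · obtain ⟨α, hα⟩ := 𝒰.covers x
      exact ⟨α, hx, hα⟩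
    · exact congrFun hst ⟨α, W α, fun x hx => hx.2, f α⟩
  exact NatTrans.mono_of_mono_app _

variable {𝒰} in
/-- The morphism from an open subset of a member of the cover to an intersection. -/
def CoverArrow.toDouble {γ : 𝒰.Index} (j : 𝒰.CoverArrow (𝒰.single γ)) :
    j.dom ⟶ 𝒰.double γ (𝒰.barBy (Hom.elt j.hom) j.idx) :=
  Hom.mk (Hom.elt j.hom) fun x hx =>
    ⟨j.hom.maps x hx, 𝒰.act_mem_barBy _ _ (j.mem x hx)⟩

/-- The tautological local primitive of a Čech cocycle in the presheaf of families. -/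
def familyPrimitive {F : Z2Sheaf τ} (g : ∀ α β, F.obj.obj (op (𝒰.double α β))) (γ : 𝒰.Index) :
    (𝒰.familyPresheaf F).obj (op (𝒰.single γ)) :=
  fun j : 𝒰.CoverArrow (𝒰.single γ) => F.obj.map j.toDouble.op (g γ (𝒰.barBy (Hom.elt j.hom) j.idx))

variable {𝒰}

/-- The second index of `familyPrimitive` depends on the group element of a composite morphism,
which is known only up to a propositional equality. This transports the cochain along that equality.
-/
lemma map_cochain_congr {F : Z2Sheaf τ} (g : ∀ α β, F.obj.obj (op (𝒰.double α β)))
    {Z : ActionOpens τ} {α β β' : 𝒰.Index} (hβ : β = β') (p : Z ⟶ 𝒰.double α β)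
    (q : Z ⟶ 𝒰.double α β') (h : Hom.elt p = Hom.elt q) :
    F.obj.map p.op (g α β) = F.obj.map q.op (g α β') := by
  subst hβ
  exact map_congr_apply _ h _

namespace IsInvariantCocycle

variable {F : Z2Sheaf τ} {g : ∀ α β, F.obj.obj (op (𝒰.double α β))}

/-- With a third index `ε` fixed, the cocycle identity reads `g γ ε - g δ ε = g γ δ`, so `γ ↦ g γ ε`
is a primitive. In the presheaf of families each component supplies such an `ε`, namely the index of
its domain moved by the group element. -/
lemma familyPrimitive_sub (hg : 𝒰.IsInvariantCocycle g) (γ δ : 𝒰.Index) :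
    (𝒰.familyPresheaf F).map (𝒰.fst γ δ).op (𝒰.familyPrimitive g γ)
      - (𝒰.familyPresheaf F).map (𝒰.snd γ δ).op (𝒰.familyPrimitive g δ)
      = (𝒰.toFamilyPresheaf F).app (op (𝒰.double γ δ)) (g γ δ) := by
  rw [sub_eq_iff_eq_add]
  funext j
  have h1 : Hom.elt (j.hom ≫ 𝒰.fst γ δ) = Hom.elt j.hom := zero_add _
  have h2 : Hom.elt (j.hom ≫ 𝒰.snd γ δ) = Hom.elt j.hom := zero_add _
  let q : j.dom ⟶ 𝒰.double δ (𝒰.barBy (Hom.elt j.hom) j.idx) :=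
    Hom.mk (Hom.elt j.hom) fun x hx =>
      ⟨(j.hom.maps x hx).2, 𝒰.act_mem_barBy _ _ (j.mem x hx)⟩
  let r : j.dom ⟶ 𝒰.double γ (𝒰.barBy (Hom.elt j.hom) j.idx) :=
    Hom.mk (Hom.elt j.hom) fun x hx =>
      ⟨(j.hom.maps x hx).1, 𝒰.act_mem_barBy _ _ (j.mem x hx)⟩
  have h := hg.cocycle _ _ _ _ j.hom q r rfl rfl
  refine (map_cochain_congr g (congrArg (fun a => 𝒰.barBy a j.idx) h1) _ r h1).trans
    (h.symm.trans (congrArg _ ?_))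
  exact (map_cochain_congr g (congrArg (fun a => 𝒰.barBy a j.idx) h2) _ q h2).symm

/-- Composing with the flip adds `1` to the group element of a component, hence applies `bar` to its
index; invariance of `g` absorbs both changes. -/
lemma familyPrimitive_flip (hg : 𝒰.IsInvariantCocycle g) (γ : 𝒰.Index) :
    (𝒰.familyPresheaf F).map (𝒰.flip γ).op (𝒰.familyPrimitive g (𝒰.bar γ))
      = 𝒰.familyPrimitive g γ := by
  funext j
  have h1 : Hom.elt (j.hom ≫ 𝒰.flip γ) = 1 + Hom.elt j.hom := rfl
  change F.obj.map (j.comp (𝒰.flip γ)).toDouble.op (g _ _) = F.obj.map j.toDouble.op (g _ _)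
  rw [← hg.invariant γ, map_map_apply]
  refine map_cochain_congr g ?_ _ _ ?_
  · exact (congrArg (fun a => 𝒰.barBy a j.idx) h1).trans (𝒰.barBy_add_one _ _)
  · exact h1

/-- An invariant Čech cocycle with values in a subsheaf of an injective `ℤ/2`-sheaf is the
coboundary of an invariant cochain of the injective sheaf. -/
theorem exists_primitive (hg : 𝒰.IsInvariantCocycle g) {J : Z2Sheaf τ} [Injective J] (ι : F ⟶ J) :
    ∃ c : ∀ α, J.obj.obj (op (𝒰.single α)),
      (∀ α β, J.obj.map (𝒰.snd α β).op (c β) - J.obj.map (𝒰.fst α β).op (c α)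
        = ι.hom.app (op (𝒰.double α β)) (g α β)) ∧
      (∀ α, J.obj.map (𝒰.flip α).op (c (𝒰.bar α)) = c α) := by
  have := J.injective_presheaf
  -- Injectivity of `J` among presheaves is what counts here: the families are never sheafified.
  let φ : 𝒰.familyPresheaf F ⟶ J.obj := Injective.factorThru ι.hom (𝒰.toFamilyPresheaf F)
  have hφ : 𝒰.toFamilyPresheaf F ≫ φ = ι.hom := Injective.comp_factorThru _ _
  have hn : ∀ {U V : ActionOpens τ} (p : U ⟶ V) (x : (𝒰.familyPresheaf F).obj (op V)),
      φ.app (op U) ((𝒰.familyPresheaf F).map p.op x) = J.obj.map p.op (φ.app (op V) x) :=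
    fun p x => ConcreteCategory.congr_hom (φ.naturality p.op) x
  -- The sign is needed because the tautological primitive has coboundary `t γ - t δ = g γ δ`,
  -- opposite to the convention for `c`.
  refine ⟨fun γ => -φ.app (op (𝒰.single γ)) (𝒰.familyPrimitive g γ), fun γ δ => ?_, fun γ => ?_⟩
  · rw [map_neg, map_neg, ← hn, ← hn, sub_neg_eq_add, neg_add_eq_sub, ← map_sub,
      hg.familyPrimitive_sub]
    exact ConcreteCategory.congr_hom (NatTrans.congr_app hφ _) _
  · rw [map_neg, ← hn, hg.familyPrimitive_flip]

end IsInvariantCocycle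

end RealCover

end Cech
-- Cycles and homology classes by elements
section Complexes

variable (K : CochainComplex AddCommGrpCat.{u} ℕ)

lemma iCycles_injective (n : ℕ) : Function.Injective (K.iCycles n) :=
  (AddCommGrpCat.mono_iff_injective _).1 inferInstance

lemma homologyπ_surjective (n : ℕ) : Function.Surjective (K.homologyπ n) :=
  (AddCommGrpCat.epi_iff_surjective _).1 inferInstance

lemma d_iCycles_apply (n : ℕ) (z : K.cycles n) : K.d n (n + 1) (K.iCycles n z) = 0 :=
  ConcreteCategory.congr_hom (K.iCycles_d n (n + 1)) z

lemma exists_iCycles_eq (n : ℕ) (x : K.X n) (hx : K.d n (n + 1) x = 0) :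
    ∃ z : K.cycles n, K.iCycles n z = x := by
  have hx' : K.d n ((ComplexShape.up ℕ).next n) x = 0 := by
    rw [CochainComplex.next]
    exact hx
  exact ⟨(K.sc n).abCyclesIso.inv ⟨x, hx'⟩, (K.sc n).abCyclesIso_inv_apply_iCycles ⟨x, hx'⟩⟩

/-- Homology is the cokernel of the map from chains to cycles, so exactness at the cycles identifies
the kernel of the projection with the boundaries. -/
lemma homologyπ_eq_zero_iff (n : ℕ) (z : K.cycles (n + 1)) :
    K.homologyπ (n + 1) z = 0 ↔ ∃ e : K.X n, K.d n (n + 1) e = K.iCycles (n + 1) z := by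
  have hex : (ShortComplex.mk _ _ (K.toCycles_comp_homologyπ n (n + 1))).Exact :=
    ShortComplex.exact_of_g_is_cokernel _ (K.homologyIsCokernel n (n + 1) (by simp))
  constructor
  · intro h
    obtain ⟨e, he⟩ := (ShortComplex.ab_exact_iff _).1 hex z h
    refine ⟨e, ?_⟩
    have h1 : K.toCycles n (n + 1) e = z := he
    rw [← h1]
    exact (ConcreteCategory.congr_hom (K.toCycles_i n (n + 1)) e).symm
  · rintro ⟨e, he⟩
    have h1 : K.toCycles n (n + 1) e = z := by
      apply iCycles_injective
      rw [← he]
      exact ConcreteCategory.congr_hom (K.toCycles_i n (n + 1)) e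
    rw [← h1]
    exact ConcreteCategory.congr_hom (K.toCycles_comp_homologyπ n (n + 1)) e

lemma homologyπ_eq_iff (n : ℕ) (z z' : K.cycles (n + 1)) :
    K.homologyπ (n + 1) z = K.homologyπ (n + 1) z' ↔
      ∃ e : K.X n, K.iCycles (n + 1) z = K.iCycles (n + 1) z' + K.d n (n + 1) e := by
  rw [← sub_eq_zero, ← map_sub, homologyπ_eq_zero_iff]
  refine exists_congr fun e => ?_
  rw [map_sub, eq_comm, sub_eq_iff_eq_add']

end Complexes

/-! ### Exactness of sheaves in terms of sections -/

section SheafExactness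

variable {E : Type*} [NormedAddCommGroup E] [NormedSpace ℝ E]
  {H : Type*} [TopologicalSpace H] {I : ModelWithCorners ℝ E H}
  {M : Type u} [TopologicalSpace M] [ChartedSpace H M] {τ : SmoothInvolution I M}

open ActionOpens

/-- The functor of sections over `U`. -/
noncomputable abbrev sectionsFunctor (U : ActionOpens τ) : Z2Sheaf τ ⥤ AddCommGrpCat.{u} :=
  sheafToPresheaf _ _ ⋙ (evaluation _ _).obj (op U)

lemma app_injective_of_mono {F G : Z2Sheaf τ} (φ : F ⟶ G) [Mono φ] (U : ActionOpens τ) :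
    Function.Injective (φ.hom.app (op U)) :=
  (AddCommGrpCat.mono_iff_injective ((sectionsFunctor U).map φ)).1 inferInstance

/-- Taking sections over `U` is left exact. -/
lemma exists_section_of_exact {S : ShortComplex (Z2Sheaf τ)} (hS : S.Exact) [Mono S.f]
    (U : ActionOpens τ) (x : S.X₂.obj.obj (op U)) (hx : S.g.hom.app (op U) x = 0) :
    ∃ y : S.X₁.obj.obj (op U), S.f.hom.app (op U) y = x := by
  have h := hS.map_of_mono_of_preservesKernel (sectionsFunctor U) inferInstance inferInstance
  exact (ShortComplex.ab_exact_iff _).1 h x hx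

lemma comp_zero_apply {S : ShortComplex (Z2Sheaf τ)} (U : ActionOpens τ)
    (y : S.X₁.obj.obj (op U)) : S.g.hom.app (op U) (S.f.hom.app (op U) y) = 0 :=
  ((S.map (sectionsFunctor U)).ab_zero_apply y)

/-- Epimorphisms of sheaves are locally surjective, but on this site the covering morphism may
involve `τ`; the conclusion removes it. -/
lemma exists_local_lift_of_epi {F G : Z2Sheaf τ} (φ : F ⟶ G) [Epi φ]
    (U : ActionOpens τ) (s : G.obj.obj (op U)) (x : M) (hx : x ∈ U.carrier) :
    ∃ (V : ActionOpens τ) (i : V ⟶ U) (_ : Hom.elt i = 0) (_ : x ∈ V.carrier)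
      (t : F.obj.obj (op V)), φ.hom.app (op V) t = G.obj.map i.op s := by
  have : Sheaf.IsLocallySurjective φ := (Sheaf.isLocallySurjective_iff_epi' _ φ).2 inferInstance
  obtain ⟨V, f, ⟨t, ht⟩, y, hy, hyx⟩ :=
    Presheaf.imageSieve_mem (ActionOpens.topology τ) φ.hom (U := op U) s x hx
  let a := Hom.elt f
  -- Transport by the group element `a` of `f`: the composite `V' ⟶ V ⟶ U` has element `a + a = 0`,
  -- so it is an inclusion.
  let V' : ActionOpens τ := ⟨⟨{z | τ.act a z ∈ V.carrier},
      V.carrier.isOpen.preimage (τ.contMDiff_act a).continuous⟩⟩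
  let p : V' ⟶ V := Hom.mk a fun z hz => hz
  have hpf : Hom.elt (p ≫ f) = 0 := CharTwo.add_self_eq_zero a
  refine ⟨V', p ≫ f, hpf, ?_, F.obj.map p.op t, ?_⟩
  · change τ.act a x ∈ V.carrier
    rw [← hyx, SmoothInvolution.act_act]
    exact hy
  · rw [Z2Sheaf.naturality_apply, ← map_map_apply]
    exact congrArg _ ht

/-- The section `s` lies in the kernel of `S.g`, and exactness says that `S.X₁` maps epimorphically
onto this kernel. -/
lemma exists_local_lift_of_exact {S : ShortComplex (Z2Sheaf τ)} (hS : S.Exact)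
    (U : ActionOpens τ) (s : S.X₂.obj.obj (op U)) (hs : S.g.hom.app (op U) s = 0)
    (x : M) (hx : x ∈ U.carrier) :
    ∃ (V : ActionOpens τ) (i : V ⟶ U) (_ : Hom.elt i = 0) (_ : x ∈ V.carrier)
      (t : S.X₁.obj.obj (op V)), S.f.hom.app (op V) t = S.X₂.obj.map i.op s := by
  have hk : (ShortComplex.mk _ _ (Limits.kernel.condition S.g)).Exact :=
    ShortComplex.exact_kernel S.g
  obtain ⟨k, hk⟩ := exists_section_of_exact hk U s hs
  have : Epi (Limits.kernel.lift S.g S.f S.zero) := S.exact_iff_epi_kernel_lift.1 hS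
  obtain ⟨V, i, hi, hxV, t, ht⟩ :=
    exists_local_lift_of_epi (Limits.kernel.lift S.g S.f S.zero) U k x hx
  refine ⟨V, i, hi, hxV, t, ?_⟩
  have h1 := congrArg ((Limits.kernel.ι S.g).hom.app (op V)) ht
  rw [Z2Sheaf.naturality_apply] at h1
  have h2 : S.f.hom.app (op V) t
      = (Limits.kernel.ι S.g).hom.app (op V) ((Limits.kernel.lift S.g S.f S.zero).hom.app _ t) := by
    conv_lhs => rw [← Limits.kernel.lift_ι S.g S.f S.zero]
    rfl
  rw [h2, h1]
  exact congrArg _ hk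

end SheafExactness
-- Čech cocycles and the first equivariant cohomology group
section CechComparison

variable {E : Type*} [NormedAddCommGroup E] [NormedSpace ℝ E]
  {H : Type*} [TopologicalSpace H] {I : ModelWithCorners ℝ E H}
  {M : Type u} [TopologicalSpace M] [ChartedSpace H M] {τ : SmoothInvolution I M}

open ActionOpens

section Resolution

variable (F : Z2Sheaf τ)

/-- The complex of invariant global sections of an injective resolution. -/
noncomputable abbrev invariantComplex : CochainComplex AddCommGrpCat.{u} ℕ :=
  ((invariantSections τ).mapHomologicalComplex (ComplexShape.up ℕ)).obj
    (injectiveResolution F).cocomplex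

/-- The `n`-th sheaf of an injective resolution of `F`. -/
noncomputable abbrev resolutionSheaf (n : ℕ) : Z2Sheaf τ := (injectiveResolution F).cocomplex.X n

/-- The inclusion of `F` into the first sheaf of its injective resolution. -/
noncomputable abbrev resolutionInclusion : F ⟶ resolutionSheaf F 0 := (injectiveResolution F).ι.f 0

/-- The differentials of an injective resolution of `F`. -/
noncomputable abbrev resolutionD (n : ℕ) : resolutionSheaf F n ⟶ resolutionSheaf F (n + 1) :=
  (injectiveResolution F).cocomplex.d n (n + 1)

/-- The cohomology class of an invariant cycle. -/
noncomputable def cohomologyClass (z : (invariantComplex F).cycles 1) :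
    equivariantCohomology τ 1 F :=
  ((injectiveResolution F).isoRightDerivedObj (invariantSections τ) 1).inv
    ((invariantComplex F).homologyπ 1 z)

lemma cohomologyClass_surjective : Function.Surjective (cohomologyClass F) := by
  refine Function.Surjective.comp ?_ (homologyπ_surjective _ 1)
  exact (AddCommGrpCat.epi_iff_surjective _).1 inferInstance

lemma cohomologyClass_eq_iff (z z' : (invariantComplex F).cycles 1) :
    cohomologyClass F z = cohomologyClass F z' ↔ ∃ e : (invariantComplex F).X 0,
      ((invariantComplex F).iCycles 1 z).1 = ((invariantComplex F).iCycles 1 z').1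
        + (resolutionD F 0).hom.app (op (whole τ)) e.1 := by
  have hinj : Function.Injective
      ((injectiveResolution F).isoRightDerivedObj (invariantSections τ) 1).inv :=
    (AddCommGrpCat.mono_iff_injective _).1 inferInstance
  unfold cohomologyClass
  refine hinj.eq_iff.trans ((homologyπ_eq_iff (invariantComplex F) 0 z z').trans ?_)
  exact exists_congr fun e => ⟨fun h => congrArg Subtype.val h, fun h => Subtype.ext h⟩

lemma resolutionD_iCycles (z : (invariantComplex F).cycles 1) :
    (resolutionD F 1).hom.app (op (whole τ)) ((invariantComplex F).iCycles 1 z).1 = 0 :=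
  congrArg Subtype.val (d_iCycles_apply (invariantComplex F) 1 z)

lemma exists_iCycles_val_eq (s : (resolutionSheaf F 1).obj.obj (op (whole τ)))
    (hs : (resolutionSheaf F 1).obj.map (ActionOpens.flip (U := whole τ) (V := whole τ)
        fun _ _ => trivial).op s = s)
    (hd : (resolutionD F 1).hom.app (op (whole τ)) s = 0) :
    ∃ z : (invariantComplex F).cycles 1, ((invariantComplex F).iCycles 1 z).1 = s := by
  obtain ⟨z, hz⟩ := exists_iCycles_eq (invariantComplex F) 1 ⟨s, hs⟩ (Subtype.ext hd)
  exact ⟨z, congrArg Subtype.val hz⟩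

/-- For an invariant section the group element of a morphism to `M` is irrelevant. This matters for
members of a cover that are reached through `τ`. -/
lemma map_whole_eq {G : Z2Sheaf τ} {s : G.obj.obj (op (whole τ))}
    (hs : G.obj.map (ActionOpens.flip (U := whole τ) (V := whole τ) fun _ _ => trivial).op s = s)
    {U : ActionOpens τ} (p q : U ⟶ whole τ) : G.obj.map p.op s = G.obj.map q.op s := by
  have key : ∀ r : U ⟶ whole τ,
      G.obj.map r.op s = G.obj.map (ActionOpens.incl (V := whole τ) fun _ _ => trivial).op s := by
    intro r
    rcases elt_eq_zero_or_one r with h | h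
    · exact map_congr_apply _ h _
    · conv_rhs => rw [← hs]
      rw [map_map_apply]
      exact map_congr_apply _ h _
  rw [key p, key q]

variable {F}

lemma resolutionD_inclusion (U : ActionOpens τ) (y : F.obj.obj (op U)) :
    (resolutionD F 0).hom.app (op U) ((resolutionInclusion F).hom.app (op U) y) = 0 :=
  comp_zero_apply
    (S := ShortComplex.mk _ _ (injectiveResolution F).ι_f_zero_comp_complex_d) U y

lemma resolutionD_resolutionD (U : ActionOpens τ) (y : (resolutionSheaf F 0).obj.obj (op U)) :
    (resolutionD F 1).hom.app (op U) ((resolutionD F 0).hom.app (op U) y) = 0 :=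
  comp_zero_apply
    (S := ShortComplex.mk _ _ ((injectiveResolution F).cocomplex.d_comp_d 0 1 2)) U y

lemma resolutionInclusion_injective (U : ActionOpens τ) :
    Function.Injective ((resolutionInclusion F).hom.app (op U)) :=
  have : Mono (resolutionInclusion F) := inferInstanceAs (Mono ((injectiveResolution F).ι.f 0))
  app_injective_of_mono (resolutionInclusion F) U

lemma exists_resolutionInclusion_eq (U : ActionOpens τ)
    (x : (resolutionSheaf F 0).obj.obj (op U)) (hx : (resolutionD F 0).hom.app (op U) x = 0) :
    ∃ y : F.obj.obj (op U), (resolutionInclusion F).hom.app (op U) y = x :=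
  have : Mono (ShortComplex.mk _ _ (injectiveResolution F).ι_f_zero_comp_complex_d).f :=
    inferInstanceAs (Mono ((injectiveResolution F).ι.f 0))
  exists_section_of_exact (injectiveResolution F).exact₀ U x hx

lemma exists_local_primitive (U : ActionOpens τ)
    (s : (resolutionSheaf F 1).obj.obj (op U)) (hs : (resolutionD F 1).hom.app (op U) s = 0)
    (x : M) (hx : x ∈ U.carrier) :
    ∃ (V : ActionOpens τ) (i : V ⟶ U) (_ : Hom.elt i = 0) (_ : x ∈ V.carrier)
      (t : (resolutionSheaf F 0).obj.obj (op V)),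
      (resolutionD F 0).hom.app (op V) t = (resolutionSheaf F 1).obj.map i.op s :=
  exists_local_lift_of_exact ((injectiveResolution F).exact_succ 0) U s hs x hx

end Resolution

namespace RealCover

variable {𝒰 : RealCover τ} {F : Z2Sheaf τ}

variable (𝒰) in
/-- `g` is the coboundary of the invariant cochain `c` of the resolution, and `z` is the
differential of `c`. -/
structure Resolves (g : ∀ α β, F.obj.obj (op (𝒰.double α β)))
    (c : ∀ α, (resolutionSheaf F 0).obj.obj (op (𝒰.single α)))
    (z : (invariantComplex F).cycles 1) : Prop where
  coboundary : ∀ α β, (resolutionSheaf F 0).obj.map (𝒰.snd α β).op (c β)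
      - (resolutionSheaf F 0).obj.map (𝒰.fst α β).op (c α)
      = (resolutionInclusion F).hom.app (op (𝒰.double α β)) (g α β)
  invariant : ∀ α, (resolutionSheaf F 0).obj.map (𝒰.flip α).op (c (𝒰.bar α)) = c α
  d_eq : ∀ α, (resolutionSheaf F 1).obj.map (𝒰.toWhole α).op ((invariantComplex F).iCycles 1 z).1
      = (resolutionD F 0).hom.app (op (𝒰.single α)) (c α)

lemma represents_iff {g : ∀ α β, F.obj.obj (op (𝒰.double α β))}
    {ξ : equivariantCohomology τ 1 F} :
    𝒰.Represents g ξ ↔ ∃ c z, 𝒰.Resolves g c z ∧ ξ = cohomologyClass F z := by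
  constructor
  · rintro ⟨c, z, h1, h2, h3, h4⟩
    exact ⟨c, z, ⟨h1, h2, h3⟩, h4⟩
  · rintro ⟨c, z, ⟨h1, h2, h3⟩, h4⟩
    exact ⟨c, z, h1, h2, h3, h4⟩

/-- The coboundary relation, pulled back along arbitrary morphisms. -/
lemma coboundary_map {G : Z2Sheaf τ} {ι : F ⟶ G} {g : ∀ α β, F.obj.obj (op (𝒰.double α β))}
    {c : ∀ α, G.obj.obj (op (𝒰.single α))}
    (hc : ∀ α β, G.obj.map (𝒰.snd α β).op (c β) - G.obj.map (𝒰.fst α β).op (c α)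
      = ι.hom.app (op (𝒰.double α β)) (g α β))
    {α β : 𝒰.Index} {Z : ActionOpens τ} (p : Z ⟶ 𝒰.single α) (q : Z ⟶ 𝒰.single β)
    (r : Z ⟶ 𝒰.double α β) (hp : Hom.elt p = Hom.elt r) (hq : Hom.elt q = Hom.elt r) :
    G.obj.map q.op (c β) - G.obj.map p.op (c α)
      = ι.hom.app (op Z) (F.obj.map r.op (g α β)) := by
  rw [Z2Sheaf.naturality_apply, ← hc, map_sub, map_map_apply, map_map_apply]
  have h1 : q = r ≫ 𝒰.snd α β := hom_ext (hq.trans (zero_add _).symm)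
  have h2 : p = r ≫ 𝒰.fst α β := hom_ext (hp.trans (zero_add _).symm)
  rw [← h1, ← h2]

/-- Invariance of the glued section can be checked on the members: on `U α`, its pullback by `τ` is
the flip of `s (bar α)`. -/
lemma exists_glue_single (G : Z2Sheaf τ) (s : ∀ α, G.obj.obj (op (𝒰.single α)))
    (hs : ∀ α β, G.obj.map (𝒰.snd α β).op (s β) = G.obj.map (𝒰.fst α β).op (s α))
    (hinv : ∀ α, G.obj.map (𝒰.flip α).op (s (𝒰.bar α)) = s α) :
    ∃ t : G.obj.obj (op (whole τ)), (∀ α, G.obj.map (𝒰.toWhole α).op t = s α) ∧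
      G.obj.map (ActionOpens.flip (U := whole τ) (V := whole τ) fun _ _ => trivial).op t = t := by
  have hcov : ∀ x ∈ (whole τ).carrier, ∃ α, x ∈ (𝒰.single α).carrier := fun x _ => 𝒰.covers x
  obtain ⟨t, ht⟩ := G.exists_glue 𝒰.single 𝒰.toWhole (fun _ => rfl) hcov s (by
    intro α β Z p q hpq
    have h1 : p = lift p q hpq ≫ 𝒰.fst α β := hom_ext (zero_add _).symm
    have h2 : q = lift p q hpq ≫ 𝒰.snd α β := hom_ext (hpq.symm.trans (zero_add _).symm)
    calc G.obj.map p.op (s α) = G.obj.map (lift p q hpq ≫ 𝒰.fst α β).op (s α) :=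
          map_congr_apply _ (congrArg Hom.elt h1) _
      _ = G.obj.map (lift p q hpq ≫ 𝒰.snd α β).op (s β) := by
          rw [← map_map_apply, ← map_map_apply, hs]
      _ = G.obj.map q.op (s β) := map_congr_apply _ (congrArg Hom.elt h2).symm _)
  refine ⟨t, ht, ?_⟩
  refine G.section_ext 𝒰.single 𝒰.toWhole (fun _ => rfl) hcov fun α => ?_
  rw [ht, ← hinv, ← ht, map_map_apply, map_map_apply]
  exact map_congr_apply _ rfl _

lemma section_ext_single (G : Z2Sheaf τ) {s t : G.obj.obj (op (whole τ))}
    (h : ∀ α, G.obj.map (𝒰.toWhole α).op s = G.obj.map (𝒰.toWhole α).op t) : s = t :=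
  G.section_ext 𝒰.single 𝒰.toWhole (fun _ => rfl) (fun x _ => 𝒰.covers x) h

/-- An invariant Čech cocycle represents a cohomology class. -/
theorem IsInvariantCocycle.exists_represents {g : ∀ α β, F.obj.obj (op (𝒰.double α β))}
    (hg : 𝒰.IsInvariantCocycle g) : ∃ ξ, 𝒰.Represents g ξ := by
  have : Injective (resolutionSheaf F 0) := (injectiveResolution F).injective 0
  obtain ⟨c, hc, hinv⟩ := hg.exists_primitive (resolutionInclusion F)
  -- The differentials `d c_α` agree on overlaps because `c_β - c_α` comes from `F`, which `d`
  -- annihilates.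
  obtain ⟨s, hs, hsinv⟩ := exists_glue_single (𝒰 := 𝒰) (resolutionSheaf F 1)
    (fun α => (resolutionD F 0).hom.app (op (𝒰.single α)) (c α))
    (fun α β => by
      rw [← Z2Sheaf.naturality_apply, ← Z2Sheaf.naturality_apply, ← sub_eq_zero, ← map_sub, hc,
        resolutionD_inclusion])
    (fun α => by rw [← Z2Sheaf.naturality_apply, hinv])
  obtain ⟨z, hz⟩ := exists_iCycles_val_eq F s hsinv (by
    refine section_ext_single (𝒰 := 𝒰) _ fun α => ?_
    rw [← Z2Sheaf.naturality_apply, hs, resolutionD_resolutionD, map_zero])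
  refine ⟨_, represents_iff.2 ⟨c, z, ⟨hc, hinv, fun α => ?_⟩, rfl⟩⟩
  rw [hz, hs]

/-- The class represented by a Čech cochain is unique. -/
theorem Represents.unique {g : ∀ α β, F.obj.obj (op (𝒰.double α β))}
    {ξ ξ' : equivariantCohomology τ 1 F} (h : 𝒰.Represents g ξ) (h' : 𝒰.Represents g ξ') :
    ξ = ξ' := by
  obtain ⟨c, z, hc, rfl⟩ := represents_iff.1 h
  obtain ⟨c', z', hc', rfl⟩ := represents_iff.1 h'
  -- Two primitives of the same `g` differ by a global invariant section `e`, and the two cycles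
  -- differ by `d e`.
  obtain ⟨e, he, heinv⟩ := exists_glue_single (𝒰 := 𝒰) (resolutionSheaf F 0)
    (fun α => c α - c' α)
    (fun α β => by
      have h1 := (hc.coboundary α β).trans (hc'.coboundary α β).symm
      rw [map_sub, map_sub, sub_eq_sub_iff_add_eq_add]
      rw [sub_eq_sub_iff_add_eq_add] at h1
      rw [h1, add_comm])
    (fun α => by rw [map_sub, hc.invariant, hc'.invariant])
  rw [cohomologyClass_eq_iff]
  refine ⟨⟨e, heinv⟩, section_ext_single (𝒰 := 𝒰) _ fun α => ?_⟩
  rw [map_add, hc.d_eq, hc'.d_eq, ← Z2Sheaf.naturality_apply, he, map_sub, add_sub_cancel]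

/-- Coboundaries of invariant cochains satisfy both identities in `I⁰`, and `F → I⁰` is injective on
sections. -/
theorem Represents.isInvariantCocycle {g : ∀ α β, F.obj.obj (op (𝒰.double α β))}
    {ξ : equivariantCohomology τ 1 F} (h : 𝒰.Represents g ξ) : 𝒰.IsInvariantCocycle g := by
  obtain ⟨c, z, hc, rfl⟩ := represents_iff.1 h
  constructor
  · intro α β γ Z p q r hpq hqr
    apply resolutionInclusion_injective
    let pα : Z ⟶ 𝒰.single α := p ≫ 𝒰.fst α β
    let pβ : Z ⟶ 𝒰.single β := p ≫ 𝒰.snd α β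
    let pγ : Z ⟶ 𝒰.single γ := q ≫ 𝒰.snd β γ
    have hα : Hom.elt pα = Hom.elt p := zero_add _
    have hβ : Hom.elt pβ = Hom.elt p := zero_add _
    have hγ : Hom.elt pγ = Hom.elt q := zero_add _
    rw [map_add, ← coboundary_map hc.coboundary pα pβ p hα hβ,
      ← coboundary_map hc.coboundary pβ pγ q (hβ.trans hpq) hγ,
      ← coboundary_map hc.coboundary pα pγ r (hα.trans (hpq.trans hqr)) (hγ.trans hqr)]
    abel
  · intro α β
    apply resolutionInclusion_injective
    rw [← coboundary_map hc.coboundary (𝒰.fst α β ≫ 𝒰.flip α) (𝒰.snd α β ≫ 𝒰.flip β) _ rfl rfl,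
      ← map_map_apply, ← map_map_apply, hc.invariant, hc.invariant, hc.coboundary]

/-- The cover by open sets `V x ∋ x` and their images under the involution. -/
def ofNhds (τ : SmoothInvolution I M) (V : M → Opens M) (hV : ∀ x, x ∈ V x) : RealCover τ where
  -- Doubling the index makes `bar` free even where `τ` has fixed points.
  Index := M × ZMod 2
  bar α := (α.1, α.2 + 1)
  bar_involutive α := Prod.ext rfl (by
    change α.2 + 1 + 1 = α.2
    rw [add_assoc, CharTwo.add_self_eq_zero, add_zero])
  bar_ne α h := by
    have h1 : ∀ a : ZMod 2, a + 1 ≠ a := by decide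
    exact h1 _ (congrArg Prod.snd h)
  set α := ⟨{y | τ.act α.2 y ∈ V α.1},
    (V α.1).isOpen.preimage (τ.contMDiff_act α.2).continuous⟩
  covers x := ⟨(x, 0), hV x⟩
  map_mem α x hx := by
    change τ.act (α.2 + 1) (τ.act 1 x) ∈ V α.1
    rw [← SmoothInvolution.act_add, add_assoc, CharTwo.add_self_eq_zero, add_zero]
    exact hx

/-- Every cohomology class is represented by a Čech cochain. -/
theorem exists_represents (ξ : equivariantCohomology τ 1 F) :
    ∃ (𝒰 : RealCover τ) (g : ∀ α β, F.obj.obj (op (𝒰.double α β))), 𝒰.Represents g ξ := by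
  obtain ⟨z, rfl⟩ := cohomologyClass_surjective F ξ
  choose V i hi hV t ht using fun x : M => exists_local_primitive (F := F) (whole τ)
    _ (resolutionD_iCycles F z) x trivial
  let 𝒰 : RealCover τ := ofNhds τ (fun x => (V x).carrier) hV
  let m : ∀ α : 𝒰.Index, 𝒰.single α ⟶ V α.1 := fun α => Hom.mk α.2 fun x hx => hx
  -- The member `(x, a)` carries the pullback by `a` of the primitive chosen near `x`, so invariance
  -- of `c` is built in.
  let c : ∀ α, (resolutionSheaf F 0).obj.obj (op (𝒰.single α)) :=
    fun α => (resolutionSheaf F 0).obj.map (m α).op (t α.1)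
  have hd : ∀ α, (resolutionSheaf F 1).obj.map (𝒰.toWhole α).op
      ((invariantComplex F).iCycles 1 z).1
      = (resolutionD F 0).hom.app (op (𝒰.single α)) (c α) := by
    intro α
    rw [Z2Sheaf.naturality_apply, ht, map_map_apply]
    exact map_whole_eq ((invariantComplex F).iCycles 1 z).2 _ _
  have hinv : ∀ α, (resolutionSheaf F 0).obj.map (𝒰.flip α).op (c (𝒰.bar α)) = c α := by
    intro α
    rw [map_map_apply]
    refine map_congr_apply _ ?_ _
    change α.2 + 1 + 1 = α.2
    rw [add_assoc, CharTwo.add_self_eq_zero, add_zero]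
  clear_value c
  -- Both `d c_α` and `d c_β` are restrictions of `z`, so the difference `c_β - c_α` is closed and
  -- comes from `F`.
  have hg : ∀ α β, ∃ y : F.obj.obj (op (𝒰.double α β)),
      (resolutionInclusion F).hom.app (op (𝒰.double α β)) y =
        (resolutionSheaf F 0).obj.map (𝒰.snd α β).op (c β)
        - (resolutionSheaf F 0).obj.map (𝒰.fst α β).op (c α) := by
    intro α β
    refine exists_resolutionInclusion_eq _ _ ?_
    rw [map_sub, Z2Sheaf.naturality_apply, Z2Sheaf.naturality_apply, ← hd, ← hd, map_map_apply,
      map_map_apply, sub_eq_zero]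
    exact map_congr_apply _ rfl _
  choose g hg using hg
  exact ⟨𝒰, g, represents_iff.2 ⟨c, z, ⟨fun α β => (hg α β).symm, hinv, hd⟩, rfl⟩⟩

/-- The intersection of members of two covers. -/
def inter (𝒰 𝒰' : RealCover τ) (α : 𝒰.Index) (α' : 𝒰'.Index) : ActionOpens τ :=
  ⟨𝒰.set α ⊓ 𝒰'.set α'⟩

/-- The involution on intersections of members of two covers. -/
def interFlip (𝒰 𝒰' : RealCover τ) (α : 𝒰.Index) (α' : 𝒰'.Index) :
    inter 𝒰 𝒰' α α' ⟶ inter 𝒰 𝒰' (𝒰.bar α) (𝒰'.bar α') :=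
  ActionOpens.flip fun x hx => ⟨𝒰.map_mem α x hx.1, 𝒰'.map_mem α' x hx.2⟩

/-- Cochains on two covers which represent the same class are cohomologous. -/
theorem Represents.exists_comparison {𝒰' : RealCover τ}
    {g : ∀ α β, F.obj.obj (op (𝒰.double α β))} {g' : ∀ α β, F.obj.obj (op (𝒰'.double α β))}
    {ξ : equivariantCohomology τ 1 F} (h : 𝒰.Represents g ξ) (h' : 𝒰'.Represents g' ξ) :
    ∃ k : ∀ α α', F.obj.obj (op (inter 𝒰 𝒰' α α')),
      (∀ α β α' β' (Z : ActionOpens τ) (p : Z ⟶ inter 𝒰 𝒰' α α') (q : Z ⟶ inter 𝒰 𝒰' β β')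
        (r : Z ⟶ 𝒰.double α β) (r' : Z ⟶ 𝒰'.double α' β'), Hom.elt p = 0 → Hom.elt q = 0 →
        Hom.elt r = 0 → Hom.elt r' = 0 →
        F.obj.map p.op (k α α') + F.obj.map r'.op (g' α' β')
          = F.obj.map r.op (g α β) + F.obj.map q.op (k β β')) ∧
      (∀ α α', F.obj.map (interFlip 𝒰 𝒰' α α').op (k (𝒰.bar α) (𝒰'.bar α')) = k α α') := by
  obtain ⟨c, z, hc, rfl⟩ := represents_iff.1 h
  obtain ⟨c', z', hc', hz⟩ := represents_iff.1 h'
  rw [cohomologyClass_eq_iff] at hz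
  obtain ⟨e, he⟩ := hz
  let pr : ∀ α α', inter 𝒰 𝒰' α α' ⟶ 𝒰.single α := fun α α' => ActionOpens.incl fun x hx => hx.1
  let pr' : ∀ α α', inter 𝒰 𝒰' α α' ⟶ 𝒰'.single α' := fun α α' => ActionOpens.incl fun x hx => hx.2
  -- The cycles differ by `d e`. Adding `e` to `c'` changes neither its coboundary nor its
  -- invariance, and gives `d b = z = d c`; hence `b - c` comes from `F` on the mixed intersections.
  let b : ∀ α', (resolutionSheaf F 0).obj.obj (op (𝒰'.single α')) := fun α' =>
    c' α' + (resolutionSheaf F 0).obj.map (𝒰'.toWhole α').op e.1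
  have hbd : ∀ α', (resolutionSheaf F 1).obj.map (𝒰'.toWhole α').op
      ((invariantComplex F).iCycles 1 z).1
      = (resolutionD F 0).hom.app (op (𝒰'.single α')) (b α') := by
    intro α'
    rw [he, map_add, hc'.d_eq, map_add, Z2Sheaf.naturality_apply]
  have hbc : ∀ α β, (resolutionSheaf F 0).obj.map (𝒰'.snd α β).op (b β)
      - (resolutionSheaf F 0).obj.map (𝒰'.fst α β).op (b α)
      = (resolutionInclusion F).hom.app (op (𝒰'.double α β)) (g' α β) := by
    intro α β
    rw [← hc'.coboundary, map_add, map_add, map_map_apply, map_map_apply]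
    have : (resolutionSheaf F 0).obj.map (𝒰'.snd α β ≫ 𝒰'.toWhole β).op e.1
        = (resolutionSheaf F 0).obj.map (𝒰'.fst α β ≫ 𝒰'.toWhole α).op e.1 :=
      map_congr_apply _ rfl _
    rw [this, add_sub_add_right_eq_sub]
  have hbi : ∀ α, (resolutionSheaf F 0).obj.map (𝒰'.flip α).op (b (𝒰'.bar α)) = b α := by
    intro α
    rw [map_add, hc'.invariant, map_map_apply]
    exact congrArg _ (map_whole_eq e.2 _ _)
  have hk : ∀ α α', ∃ y : F.obj.obj (op (inter 𝒰 𝒰' α α')),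
      (resolutionInclusion F).hom.app (op (inter 𝒰 𝒰' α α')) y =
        (resolutionSheaf F 0).obj.map (pr' α α').op (b α')
        - (resolutionSheaf F 0).obj.map (pr α α').op (c α) := by
    intro α α'
    refine exists_resolutionInclusion_eq _ _ ?_
    rw [map_sub, Z2Sheaf.naturality_apply, Z2Sheaf.naturality_apply, ← hbd, ← hc.d_eq,
      map_map_apply, map_map_apply, sub_eq_zero]
    exact map_congr_apply _ rfl _
  choose k hk using hk
  refine ⟨k, ?_, ?_⟩
  · intro α β α' β' Z p q r r' hp hq hr hr'
    apply resolutionInclusion_injective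
    have e1 : Hom.elt (p ≫ pr α α') = 0 := (zero_add _).trans hp
    have e2 : Hom.elt (q ≫ pr β β') = 0 := (zero_add _).trans hq
    have e1' : Hom.elt (p ≫ pr' α α') = 0 := (zero_add _).trans hp
    have e2' : Hom.elt (q ≫ pr' β β') = 0 := (zero_add _).trans hq
    -- In `I⁰` both sides equal `b β' - c α`.
    rw [map_add, map_add, Z2Sheaf.naturality_apply _ p, Z2Sheaf.naturality_apply _ q, hk, hk,
      ← coboundary_map hc.coboundary (p ≫ pr α α') (q ≫ pr β β') r (e1.trans hr.symm)
        (e2.trans hr.symm),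
      ← coboundary_map hbc (p ≫ pr' α α') (q ≫ pr' β β') r' (e1'.trans hr'.symm)
        (e2'.trans hr'.symm), map_sub, map_sub, map_map_apply, map_map_apply, map_map_apply,
      map_map_apply]
    abel
  · intro α α'
    apply resolutionInclusion_injective
    rw [Z2Sheaf.naturality_apply, hk, hk, map_sub, map_map_apply, map_map_apply, ← hbi α',
      ← hc.invariant α, map_map_apply, map_map_apply]
    rfl

/-- The disjoint union of two covers. -/
def sum (𝒰 𝒰' : RealCover τ) : RealCover τ where
  Index := 𝒰.Index ⊕ 𝒰'.Index
  bar := Sum.map 𝒰.bar 𝒰'.bar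
  bar_involutive := by
    rintro (α | α)
    · exact congrArg Sum.inl (𝒰.bar_involutive α)
    · exact congrArg Sum.inr (𝒰'.bar_involutive α)
  bar_ne := by
    rintro (α | α) h
    · exact 𝒰.bar_ne α (Sum.inl_injective h)
    · exact 𝒰'.bar_ne α (Sum.inr_injective h)
  set := Sum.elim 𝒰.set 𝒰'.set
  covers x := by
    obtain ⟨α, hα⟩ := 𝒰.covers x
    exact ⟨Sum.inl α, hα⟩
  map_mem := by
    rintro (α | α) x hx
    · exact 𝒰.map_mem α x hx
    · exact 𝒰'.map_mem α x hx

/-- Restricting the primitive to a subfamily that still covers leaves the cycle `z` unchanged. The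
disjoint union thus plays the part of a common refinement. -/
lemma Represents.sum_inl {𝒰' : RealCover τ}
    {g : ∀ α β, F.obj.obj (op ((𝒰.sum 𝒰').double α β))} {ξ : equivariantCohomology τ 1 F}
    (h : (𝒰.sum 𝒰').Represents g ξ) :
    𝒰.Represents (fun α β => g (Sum.inl α) (Sum.inl β)) ξ := by
  obtain ⟨c, z, hc, hξ⟩ := represents_iff.1 h
  exact represents_iff.2 ⟨fun α => c (Sum.inl α), z,
    ⟨fun α β => hc.coboundary (Sum.inl α) (Sum.inl β), fun α => hc.invariant (Sum.inl α),
    fun α => hc.d_eq (Sum.inl α)⟩, hξ⟩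

lemma Represents.sum_inr {𝒰' : RealCover τ}
    {g : ∀ α β, F.obj.obj (op ((𝒰.sum 𝒰').double α β))} {ξ : equivariantCohomology τ 1 F}
    (h : (𝒰.sum 𝒰').Represents g ξ) :
    𝒰'.Represents (fun α β => g (Sum.inr α) (Sum.inr β)) ξ := by
  obtain ⟨c, z, hc, hξ⟩ := represents_iff.1 h
  exact represents_iff.2 ⟨fun α => c (Sum.inr α), z,
    ⟨fun α β => hc.coboundary (Sum.inr α) (Sum.inr β), fun α => hc.invariant (Sum.inr α),
    fun α => hc.d_eq (Sum.inr α)⟩, hξ⟩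

end RealCover

end CechComparison
-- Smooth functions with values in the complex numbers and the circle
section Smooth

variable {EN : Type*} [NormedAddCommGroup EN] [NormedSpace ℝ EN] {HN : Type*} [TopologicalSpace HN]
  {J : ModelWithCorners ℝ EN HN} {N : Type*} [TopologicalSpace N] [ChartedSpace HN N]

lemma contMDiffAt_mul_complex {f g : N → ℂ} {x : N} (hf : ContMDiffAt J 𝓘(ℝ, ℂ) ∞ f x)
    (hg : ContMDiffAt J 𝓘(ℝ, ℂ) ∞ g x) : ContMDiffAt J 𝓘(ℝ, ℂ) ∞ (fun y => f y * g y) x := by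
  have h : ContDiffAt ℝ ∞ (fun p : ℂ × ℂ => p.1 * p.2) (f x, g x) := contDiff_mul.contDiffAt
  exact h.contMDiffAt.comp x (hf.prodMk_space hg)

lemma contMDiffAt_inv_complex {f : N → ℂ} {x : N} (hf : ContMDiffAt J 𝓘(ℝ, ℂ) ∞ f x)
    (hx : f x ≠ 0) : ContMDiffAt J 𝓘(ℝ, ℂ) ∞ (fun y => (f y)⁻¹) x := by
  have h : ContDiffAt ℝ ∞ (fun z : ℂ => z⁻¹) (f x) := contDiffAt_inv ℝ hx
  exact h.contMDiffAt.comp x hf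

lemma contMDiffAt_div_complex {f g : N → ℂ} {x : N} (hf : ContMDiffAt J 𝓘(ℝ, ℂ) ∞ f x)
    (hg : ContMDiffAt J 𝓘(ℝ, ℂ) ∞ g x) (hx : g x ≠ 0) :
    ContMDiffAt J 𝓘(ℝ, ℂ) ∞ (fun y => f y / g y) x := by
  simp only [div_eq_mul_inv]
  exact contMDiffAt_mul_complex hf (contMDiffAt_inv_complex hg hx)

lemma contMDiffAt_norm_complex {f : N → ℂ} {x : N} (hf : ContMDiffAt J 𝓘(ℝ, ℂ) ∞ f x)
    (hx : f x ≠ 0) : ContMDiffAt J 𝓘(ℝ, ℝ) ∞ (fun y => ‖f y‖) x :=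
  (contDiffAt_norm ℝ hx).contMDiffAt.comp x hf

lemma contMDiffAt_ofReal {f : N → ℝ} {x : N} (hf : ContMDiffAt J 𝓘(ℝ, ℝ) ∞ f x) :
    ContMDiffAt J 𝓘(ℝ, ℂ) ∞ (fun y => (f y : ℂ)) x :=
  (Complex.ofRealCLM.contDiff.contDiffAt (x := f x)).contMDiffAt.comp x hf

lemma contMDiff_coe_circle : ContMDiff (𝓡 1) 𝓘(ℝ, ℂ) ∞ (fun z : Circle => (z : ℂ)) :=
  have : Fact (Module.finrank ℝ ℂ = 1 + 1) := finrank_real_complex_fact'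
  contMDiff_coe_sphere (E := ℂ) (n := 1)

lemma contMDiff_circle_of_coe [IsManifold J ∞ N] {f : N → Circle}
    (hf : ContMDiff J 𝓘(ℝ, ℂ) ∞ (fun y => (f y : ℂ))) : ContMDiff J (𝓡 1) ∞ f :=
  have : Fact (Module.finrank ℝ ℂ = 1 + 1) := finrank_real_complex_fact'
  ContMDiff.codRestrict_sphere (E := ℂ) (n := 1) hf fun y => (f y).2

end Smooth

/-! ### Coordinates, quotients of sections and norms on a line bundle -/

section LineBundles

variable {E : Type*} [NormedAddCommGroup E] [NormedSpace ℝ E]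
  {H : Type*} [TopologicalSpace H] {I : ModelWithCorners ℝ E H}
  {M : Type u} [TopologicalSpace M] [ChartedSpace H M]

namespace LineBundle

variable (L : LineBundle.{u, v} I M)

/-- The total space of a line bundle. -/
abbrev Total : Type (max u v) := Bundle.TotalSpace ℂ L.Fiber

/-- The coordinate of a vector in the trivialization at `x`. -/
noncomputable def coord (x : M) (p : L.Total) : ℂ := (trivializationAt ℂ L.Fiber x p).2

variable {L}

lemma coord_smul {x y : M} (hy : y ∈ (trivializationAt ℂ L.Fiber x).baseSet) (a : ℂ)
    (v : L.Fiber y) : L.coord x ⟨y, a • v⟩ = a * L.coord x ⟨y, v⟩ :=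
  ((trivializationAt ℂ L.Fiber x).linear ℂ hy).map_smul a v

lemma coord_injective {x y : M} (hy : y ∈ (trivializationAt ℂ L.Fiber x).baseSet) :
    Function.Injective fun v : L.Fiber y => L.coord x ⟨y, v⟩ :=
  ((trivializationAt ℂ L.Fiber x).linearEquivAt ℂ y hy).injective

lemma coord_ne_zero {x y : M} (hy : y ∈ (trivializationAt ℂ L.Fiber x).baseSet) {v : L.Fiber y}
    (hv : v ≠ 0) : L.coord x ⟨y, v⟩ ≠ 0 := by
  intro h
  apply hv
  apply coord_injective hy
  have h0 := coord_smul hy 0 (0 : L.Fiber y)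
  rw [zero_smul, zero_mul] at h0
  exact h.trans h0.symm

/-- The quotient of two vectors in a fibre of a line bundle. -/
noncomputable def ratio {x : M} (w v : L.Fiber x) : ℂ := L.coord x ⟨x, w⟩ / L.coord x ⟨x, v⟩

lemma ratio_smul_self {x : M} (w : L.Fiber x) {v : L.Fiber x} (hv : v ≠ 0) :
    ratio w v • v = w := by
  have hx := FiberBundle.mem_baseSet_trivializationAt ℂ L.Fiber x
  apply coord_injective hx
  change L.coord x _ = L.coord x _
  rw [coord_smul hx, ratio, div_mul_cancel₀ _ (coord_ne_zero hx hv)]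

lemma smul_left_inj {x : M} {v : L.Fiber x} (hv : v ≠ 0) {a b : ℂ} (h : a • v = b • v) :
    a = b := by
  have hx := FiberBundle.mem_baseSet_trivializationAt ℂ L.Fiber x
  have h1 := congrArg (fun w => L.coord x ⟨x, w⟩) h
  simp only [coord_smul hx] at h1
  exact mul_right_cancel₀ (coord_ne_zero hx hv) h1

lemma ratio_eq_iff {x : M} {w v : L.Fiber x} (hv : v ≠ 0) {a : ℂ} : ratio w v = a ↔ w = a • v := by
  constructor
  · rintro rfl
    exact (ratio_smul_self w hv).symm
  · rintro h
    apply smul_left_inj hv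
    rw [ratio_smul_self w hv, h]

/-- The definition of `ratio` uses a trivialization that varies with the point. Any fixed one gives
the same value, which is what smoothness arguments need. -/
lemma ratio_eq_coord_div {x y : M} (hy : y ∈ (trivializationAt ℂ L.Fiber x).baseSet)
    (w : L.Fiber y) {v : L.Fiber y} (hv : v ≠ 0) :
    ratio w v = L.coord x ⟨y, w⟩ / L.coord x ⟨y, v⟩ := by
  rw [ratio_eq_iff hv]
  apply coord_injective hy
  change L.coord x _ = L.coord x _
  rw [coord_smul hy, div_mul_cancel₀ _ (coord_ne_zero hy hv)]

variable {EN : Type*} [NormedAddCommGroup EN] [NormedSpace ℝ EN] {HN : Type*} [TopologicalSpace HN]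
  {J : ModelWithCorners ℝ EN HN} {N : Type*} [TopologicalSpace N] [ChartedSpace HN N]

lemma contMDiffAt_iff_coord {f : N → L.Total} {n : N} {x : M}
    (hx : (f n).1 ∈ (trivializationAt ℂ L.Fiber x).baseSet) :
    ContMDiffAt J (I.prod 𝓘(ℝ, ℂ)) ∞ f n ↔
      ContMDiffAt J I ∞ (fun m => (f m).1) n ∧
        ContMDiffAt J 𝓘(ℝ, ℂ) ∞ (fun m => L.coord x (f m)) n :=
  (trivializationAt ℂ L.Fiber x).contMDiffAt_iff
    ((trivializationAt ℂ L.Fiber x).mem_source.2 hx)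

lemma contMDiffAt_coord {x : M} {p : L.Total}
    (hx : p.1 ∈ (trivializationAt ℂ L.Fiber x).baseSet) :
    ContMDiffAt (I.prod 𝓘(ℝ, ℂ)) 𝓘(ℝ, ℂ) ∞ (L.coord x) p :=
  ((contMDiffAt_iff_coord (f := id) hx).1 contMDiffAt_id).2

lemma eventually_mem_baseSet {b : N → M} {n : N} (hb : ContMDiffAt J I ∞ b n) :
    ∀ᶠ m in nhds n, b m ∈ (trivializationAt ℂ L.Fiber (b n)).baseSet :=
  hb.continuousAt ((trivializationAt ℂ L.Fiber (b n)).open_baseSet.mem_nhds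
    (FiberBundle.mem_baseSet_trivializationAt ℂ L.Fiber (b n)))

lemma contMDiffAt_ratio {b : N → M} {w v : ∀ n, L.Fiber (b n)} {n : N}
    (hw : ContMDiffAt J (I.prod 𝓘(ℝ, ℂ)) ∞ (fun m => (⟨b m, w m⟩ : L.Total)) n)
    (hv : ContMDiffAt J (I.prod 𝓘(ℝ, ℂ)) ∞ (fun m => (⟨b m, v m⟩ : L.Total)) n)
    (h0 : ∀ᶠ m in nhds n, v m ≠ 0) :
    ContMDiffAt J 𝓘(ℝ, ℂ) ∞ (fun m => ratio (w m) (v m)) n := by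
  have hx := FiberBundle.mem_baseSet_trivializationAt ℂ L.Fiber (b n)
  obtain ⟨hb, hw⟩ := (contMDiffAt_iff_coord (x := b n) hx).1 hw
  obtain ⟨-, hv⟩ := (contMDiffAt_iff_coord (x := b n) hx).1 hv
  refine (contMDiffAt_div_complex hw hv (coord_ne_zero hx h0.self_of_nhds)).congr_of_eventuallyEq ?_
  filter_upwards [h0, eventually_mem_baseSet (L := L) hb] with m hm hbm
  exact ratio_eq_coord_div hbm _ hm

lemma contMDiffAt_smul {b : N → M} {a : N → ℂ} {v : ∀ n, L.Fiber (b n)} {n : N}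
    (ha : ContMDiffAt J 𝓘(ℝ, ℂ) ∞ a n)
    (hv : ContMDiffAt J (I.prod 𝓘(ℝ, ℂ)) ∞ (fun m => (⟨b m, v m⟩ : L.Total)) n) :
    ContMDiffAt J (I.prod 𝓘(ℝ, ℂ)) ∞ (fun m => (⟨b m, a m • v m⟩ : L.Total)) n := by
  have hx := FiberBundle.mem_baseSet_trivializationAt ℂ L.Fiber (b n)
  obtain ⟨hb, hv⟩ := (contMDiffAt_iff_coord (x := b n) hx).1 hv
  refine (contMDiffAt_iff_coord (x := b n) hx).2 ⟨hb, ?_⟩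
  refine (contMDiffAt_mul_complex ha hv).congr_of_eventuallyEq ?_
  filter_upwards [eventually_mem_baseSet (L := L) hb] with m hbm
  exact coord_smul hbm _ _

/-- The local section which is constant in the trivialization at `x`. -/
noncomputable def frame (L : LineBundle.{u, v} I M) (x y : M) : L.Fiber y :=
  (trivializationAt ℂ L.Fiber x).symm y 1

lemma coord_frame {x y : M} (hy : y ∈ (trivializationAt ℂ L.Fiber x).baseSet) :
    L.coord x ⟨y, L.frame x y⟩ = 1 := by
  unfold coord frame
  rw [Bundle.Trivialization.apply_mk_symm _ hy]

lemma frame_ne_zero {x y : M} (hy : y ∈ (trivializationAt ℂ L.Fiber x).baseSet) :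
    L.frame x y ≠ 0 := by
  intro h
  have h1 := coord_frame hy
  rw [h] at h1
  have h0 := coord_smul hy 0 (0 : L.Fiber y)
  rw [zero_smul, zero_mul, h1] at h0
  exact one_ne_zero h0

lemma contMDiffAt_frame {x y : M} (hy : y ∈ (trivializationAt ℂ L.Fiber x).baseSet) :
    ContMDiffAt I (I.prod 𝓘(ℝ, ℂ)) ∞ (fun z => (⟨z, L.frame x z⟩ : L.Total)) y := by
  refine (contMDiffAt_iff_coord (x := x) hy).2 ⟨contMDiffAt_id, ?_⟩
  refine (contMDiffAt_const (c := (1 : ℂ))).congr_of_eventuallyEq ?_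
  filter_upwards [(trivializationAt ℂ L.Fiber x).open_baseSet.mem_nhds hy] with z hz
  exact coord_frame hz

/-- A fibrewise norm on a line bundle, smooth away from the zero section. -/
structure IsNorm (L : LineBundle.{u, v} I M) (nu : L.Total → ℝ) : Prop where
  smul : ∀ (x : M) (a : ℂ) (v : L.Fiber x), nu ⟨x, a • v⟩ = ‖a‖ * nu ⟨x, v⟩
  pos : ∀ (x : M) (v : L.Fiber x), v ≠ 0 → 0 < nu ⟨x, v⟩
  contMDiffAt : ∀ p : L.Total, p.2 ≠ 0 → ContMDiffAt (I.prod 𝓘(ℝ, ℂ)) 𝓘(ℝ, ℝ) ∞ nu p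

/-- Absolute values of coordinates are local norms, and sums of norms with nonnegative weights, not
all zero, are norms; a partition of unity supplies the weights. -/
lemma exists_isNorm [FiniteDimensional ℝ E] [IsManifold I ∞ M] [T2Space M] [SigmaCompactSpace M]
    (L : LineBundle.{u, v} I M) : ∃ nu, L.IsNorm nu := by
  obtain ⟨ρ, hρ⟩ := SmoothPartitionOfUnity.exists_isSubordinate I (isClosed_univ (X := M))
    (fun x => (trivializationAt ℂ L.Fiber x).baseSet)
    (fun x => (trivializationAt ℂ L.Fiber x).open_baseSet)
    (fun x _ => Set.mem_iUnion.2 ⟨x, FiberBundle.mem_baseSet_trivializationAt ℂ L.Fiber x⟩)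
  have hmem : ∀ i x, ρ i x ≠ 0 → x ∈ (trivializationAt ℂ L.Fiber i).baseSet :=
    fun i x h => hρ i (subset_tsupport _ h)
  have hfin : ∀ p : L.Total, (Function.support fun i => ρ i p.1 * ‖L.coord i p‖).Finite :=
    fun p => (ρ.locallyFinite.point_finite p.1).subset fun i hi => left_ne_zero_of_mul hi
  refine ⟨fun p => ∑ᶠ i, ρ i p.1 * ‖L.coord i p‖, ?_, ?_, ?_⟩
  · intro x a v
    rw [mul_finsum]
    refine finsum_congr fun i => ?_
    -- Outside the base set the coordinate is not known to be linear, but there its weight vanishes.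
    by_cases h : ρ i x = 0
    · simp only [h, zero_mul, mul_zero]
    · rw [coord_smul (hmem i x h), norm_mul]
      ring
  · intro x v hv
    obtain ⟨i, hi⟩ := ρ.exists_pos_of_mem (Set.mem_univ x)
    refine finsum_pos (fun j => mul_nonneg (ρ.nonneg j x) (norm_nonneg _)) ⟨i, ?_⟩ (hfin _)
    exact mul_pos hi (norm_pos_iff.2 (coord_ne_zero (hmem i x hi.ne') hv))
  · intro p hp
    have hcont : Continuous (Bundle.TotalSpace.proj : L.Total → M) :=
      FiberBundle.continuous_proj ℂ L.Fiber
    refine contMDiffAt_finsum ?_ fun i => ?_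
    · exact (ρ.locallyFinite.preimage_continuous hcont).subset
        fun i q hq => left_ne_zero_of_mul hq
    · have hρi : ContMDiffAt (I.prod 𝓘(ℝ, ℂ)) 𝓘(ℝ, ℝ) ∞ (fun q : L.Total => ρ i q.1) p :=
        (ρ i).contMDiff.contMDiffAt.comp p (Bundle.contMDiffAt_proj L.Fiber)
      -- On the closed support the coordinate is smooth and nonzero; off it the whole term vanishes
      -- nearby.
      by_cases h : p.1 ∈ tsupport (ρ i)
      · have h1 := contMDiffAt_norm_complex (contMDiffAt_coord (hρ i h)) (coord_ne_zero (hρ i h) hp)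
        exact hρi.mul h1
      · refine (contMDiffAt_const (c := (0 : ℝ))).congr_of_eventuallyEq ?_
        have h2 := hcont.continuousAt (x := p) ((isClosed_tsupport (ρ i)).isOpen_compl.mem_nhds h)
        filter_upwards [h2] with q hq
        rw [image_eq_zero_of_notMem_tsupport hq, zero_mul]

end LineBundle

end LineBundles
-- Invariant frame systems and the class of a bundle
lemma LiftKind.norm_onComplex (κ : LiftKind) (a : ℂ) : ‖κ.onComplex a‖ = ‖a‖ := by
  cases κ
  · rfl
  · exact RCLike.norm_conj a

lemma LiftKind.onComplex_ofReal (κ : LiftKind) (r : ℝ) : κ.onComplex (r : ℂ) = r := by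
  cases κ
  · rfl
  · exact Complex.conj_ofReal r

section LiftedBundles

variable {E : Type*} [NormedAddCommGroup E] [NormedSpace ℝ E]
  {H : Type*} [TopologicalSpace H] {I : ModelWithCorners ℝ E H}
  {M : Type u} [TopologicalSpace M] [ChartedSpace H M]
  {κ : LiftKind} {τ : SmoothInvolution I M}

/-- Circle valued functions on the intersections of a cover form an invariant cocycle if they do
so pointwise. -/
lemma isInvariantCocycle_of_pointwise {𝒰 : RealCover τ}
    {g : ∀ α β, CircleFunctions τ (𝒰.double α β)}
    (hcoc : ∀ α β γ x (h₁ : x ∈ (𝒰.double α β).carrier) (h₂ : x ∈ (𝒰.double β γ).carrier)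
      (h₃ : x ∈ (𝒰.double α γ).carrier), g α β ⟨x, h₁⟩ * g β γ ⟨x, h₂⟩ = g α γ ⟨x, h₃⟩)
    (hinv : ∀ α β x (h : x ∈ (𝒰.double α β).carrier)
      (h' : τ x ∈ (𝒰.double (𝒰.bar α) (𝒰.bar β)).carrier),
      κ.onCircle (g (𝒰.bar α) (𝒰.bar β) ⟨τ x, h'⟩) = g α β ⟨x, h⟩) :
    𝒰.IsInvariantCocycle (F := circleSheaf κ τ) (fun α β => Additive.ofMul (g α β)) := by
  constructor
  · intro α β γ Z p q r hpq hqr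
    -- Once all three morphisms literally have the element of `q`, the functions are evaluated at
    -- the same point.
    have hpq' : p = ⟨q.elt, fun x hx => hpq ▸ p.maps x hx⟩ := ActionOpens.hom_ext hpq
    have hrq' : r = ⟨q.elt, fun x hx => hqr ▸ r.maps x hx⟩ := ActionOpens.hom_ext hqr.symm
    refine congrArg Additive.ofMul (ContMDiffMap.ext fun x => ?_ :
      circlePullback κ p (g α β) * circlePullback κ q (g β γ) = circlePullback κ r (g α γ))
    rw [hpq', hrq']
    change circlePullback κ _ (g α β) x * circlePullback κ q (g β γ) x = _
    rw [circlePullback_apply, circlePullback_apply, circlePullback_apply, ← map_mul, hcoc]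
  · intro α β
    refine congrArg Additive.ofMul (ContMDiffMap.ext fun x => ?_ :
      circlePullback κ (𝒰.doubleFlip α β) (g (𝒰.bar α) (𝒰.bar β)) = g α β)
    exact hinv α β x x.2 ((𝒰.doubleFlip α β).maps x x.2)

/-- The pointwise form of the cocycle conditions. -/
lemma pointwise_of_isInvariantCocycle {𝒰 : RealCover τ}
    {g : ∀ α β, CircleFunctions τ (𝒰.double α β)}
    (hg : 𝒰.IsInvariantCocycle (F := circleSheaf κ τ) (fun α β => Additive.ofMul (g α β))) :
    (∀ α β γ x (h₁ : x ∈ (𝒰.double α β).carrier) (h₂ : x ∈ (𝒰.double β γ).carrier)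
      (h₃ : x ∈ (𝒰.double α γ).carrier), g α β ⟨x, h₁⟩ * g β γ ⟨x, h₂⟩ = g α γ ⟨x, h₃⟩) ∧
    (∀ α β x (h : x ∈ (𝒰.double α β).carrier)
      (h' : τ x ∈ (𝒰.double (𝒰.bar α) (𝒰.bar β)).carrier),
      κ.onCircle (g (𝒰.bar α) (𝒰.bar β) ⟨τ x, h'⟩) = g α β ⟨x, h⟩) := by
  constructor
  · intro α β γ x h₁ h₂ h₃
    let Z : ActionOpens τ := ⟨𝒰.set α ⊓ 𝒰.set β ⊓ 𝒰.set γ⟩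
    have hx : x ∈ Z.carrier := ⟨h₁, h₂.2⟩
    have h := hg.cocycle α β γ Z (ActionOpens.incl fun y hy => hy.1)
      (ActionOpens.incl fun y hy => ⟨hy.1.2, hy.2⟩) (ActionOpens.incl fun y hy => ⟨hy.1.1, hy.2⟩)
      rfl rfl
    exact congrArg (fun f : Additive (CircleFunctions τ Z) => f.toMul ⟨x, hx⟩) h
  · intro α β x h h'
    exact congrArg (fun f : Additive (CircleFunctions τ (𝒰.double α β)) => f.toMul ⟨x, h⟩)
      (hg.invariant α β)

namespace LiftedLineBundle

variable (L : LiftedLineBundle.{u, v} κ τ)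

/-- The lift of the involution as a map of the total space. -/
def totalLift (p : L.toLineBundle.Total) : L.toLineBundle.Total := ⟨τ p.1, L.lift p.1 p.2⟩

lemma totalLift_totalLift (p : L.toLineBundle.Total) : L.totalLift (L.totalLift p) = p :=
  L.lift_lift p

lemma contMDiff_totalLift : ContMDiff (I.prod 𝓘(ℝ, ℂ)) (I.prod 𝓘(ℝ, ℂ)) ∞ L.totalLift :=
  L.contMDiff_lift

lemma total_mk_inj {x : M} {v w : L.Fiber x}
    (h : (⟨x, v⟩ : L.toLineBundle.Total) = ⟨x, w⟩) : v = w :=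
  Bundle.TotalSpace.mk_injective x h

lemma lift_injective (x : M) : Function.Injective (L.lift x) := by
  intro v w h
  apply L.total_mk_inj
  have h1 : L.totalLift ⟨x, v⟩ = L.totalLift ⟨x, w⟩ := congrArg (Bundle.TotalSpace.mk (τ x)) h
  rw [← L.totalLift_totalLift ⟨x, v⟩, h1, L.totalLift_totalLift]

lemma lift_ne_zero {x : M} {v : L.Fiber x} (hv : v ≠ 0) : L.lift x v ≠ 0 := by
  intro h
  apply hv
  apply L.lift_injective x
  rw [h, map_zero]

/-- The preimage of `w` is its own lift, but that lies in the fibre over `τ (τ x)`. The second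
clause records the identification in the total space, where no transport is needed. -/
lemma exists_lift_eq (x : M) (w : L.Fiber (τ x)) : ∃ v : L.Fiber x,
    L.lift x v = w ∧ (⟨x, v⟩ : L.toLineBundle.Total) = L.totalLift ⟨τ x, w⟩ := by
  have h : ∀ p : L.toLineBundle.Total, p.1 = x →
      ∃ v : L.Fiber x, (⟨x, v⟩ : L.toLineBundle.Total) = p := by
    rintro ⟨y, v⟩ rfl
    exact ⟨v, rfl⟩
  obtain ⟨v, hv⟩ := h (L.totalLift ⟨τ x, w⟩) (τ.involutive x)
  refine ⟨v, L.total_mk_inj ?_, hv⟩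
  change L.totalLift ⟨x, v⟩ = _
  rw [hv, totalLift_totalLift]

/-- Every line bundle with a lift has a fibrewise norm which is invariant under the lift. -/
lemma exists_invariant_norm [FiniteDimensional ℝ E] [IsManifold I ∞ M] [T2Space M]
    [SigmaCompactSpace M] : ∃ nu, L.toLineBundle.IsNorm nu ∧ ∀ p, nu (L.totalLift p) = nu p := by
  obtain ⟨nu, hnu⟩ := L.toLineBundle.exists_isNorm
  -- Averaging over the group of order two.
  refine ⟨fun p => nu p + nu (L.totalLift p), ⟨fun x a v => ?_, fun x v hv => ?_, fun p hp => ?_⟩,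
    fun p => ?_⟩
  · have h : L.totalLift ⟨x, a • v⟩ = ⟨τ x, κ.onComplex a • L.lift x v⟩ := by
      rw [totalLift, map_smulₛₗ]
    rw [h, hnu.smul, hnu.smul, κ.norm_onComplex, mul_add]
    rfl
  · exact add_pos (hnu.pos x v hv) (hnu.pos _ _ (L.lift_ne_zero hv))
  · exact (hnu.contMDiffAt p hp).add
      ((hnu.contMDiffAt _ (L.lift_ne_zero hp)).comp p (L.contMDiff_totalLift p))
  · simp only [totalLift_totalLift, add_comm]

/-- A system of nowhere zero smooth sections on the members of a cover, invariant under the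
lift. -/
structure IsFrameSystem (𝒰 : RealCover τ) (s : 𝒰.Index → ∀ x, L.Fiber x) : Prop where
  contMDiffOn : ∀ α, ContMDiffOn I (I.prod 𝓘(ℝ, ℂ)) ∞
    (fun x => (⟨x, s α x⟩ : L.toLineBundle.Total)) (𝒰.set α)
  ne_zero : ∀ α, ∀ x ∈ 𝒰.set α, s α x ≠ 0
  equivariant : ∀ α, ∀ x ∈ 𝒰.set α, s (𝒰.bar α) (τ x) = L.lift x (s α x)

variable {L}

namespace IsFrameSystem

variable {𝒰 : RealCover τ} {s : 𝒰.Index → ∀ x, L.Fiber x}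

lemma contMDiffAt (hs : L.IsFrameSystem 𝒰 s) {α : 𝒰.Index} {x : M} (hx : x ∈ 𝒰.set α) :
    ContMDiffAt I (I.prod 𝓘(ℝ, ℂ)) ∞ (fun x => (⟨x, s α x⟩ : L.toLineBundle.Total)) x :=
  (hs.contMDiffOn α).contMDiffAt ((𝒰.set α).isOpen.mem_nhds hx)

/-- The normalising factor is invariant because the norm is, and real, so it passes unchanged
through an antilinear lift. -/
lemma normalize (hs : L.IsFrameSystem 𝒰 s) {nu : L.toLineBundle.Total → ℝ}
    (hnu : L.toLineBundle.IsNorm nu) (hinv : ∀ p, nu (L.totalLift p) = nu p) :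
    L.IsFrameSystem 𝒰 (fun α x => (((nu ⟨x, s α x⟩)⁻¹ : ℝ) : ℂ) • s α x) := by
  refine ⟨fun α x hx => ?_, fun α x hx => ?_, fun α x hx => ?_⟩
  · refine (LineBundle.contMDiffAt_smul ?_ (hs.contMDiffAt hx)).contMDiffWithinAt
    refine contMDiffAt_ofReal ?_
    have h1 : ContMDiffAt I 𝓘(ℝ, ℝ) ∞ (fun y => nu ⟨y, s α y⟩) x :=
      (hnu.contMDiffAt ⟨x, s α x⟩ (hs.ne_zero α x hx)).comp x (hs.contMDiffAt hx)
    have h2 : ContDiffAt ℝ ∞ (fun r : ℝ => r⁻¹) (nu ⟨x, s α x⟩) :=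
      contDiffAt_inv ℝ (hnu.pos _ _ (hs.ne_zero α x hx)).ne'
    exact h2.contMDiffAt.comp x h1
  · refine smul_ne_zero ?_ (hs.ne_zero α x hx)
    exact Complex.ofReal_ne_zero.2 (inv_ne_zero (hnu.pos _ _ (hs.ne_zero α x hx)).ne')
  · have h : nu ⟨τ x, s (𝒰.bar α) (τ x)⟩ = nu ⟨x, s α x⟩ := by
      rw [hs.equivariant α x hx]
      exact hinv ⟨x, s α x⟩
    rw [h, map_smulₛₗ, κ.onComplex_ofReal, hs.equivariant α x hx]

lemma norm_normalize (hs : L.IsFrameSystem 𝒰 s) {nu : L.toLineBundle.Total → ℝ}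
    (hnu : L.toLineBundle.IsNorm nu) {α : 𝒰.Index} {x : M} (hx : x ∈ 𝒰.set α) :
    nu ⟨x, (((nu ⟨x, s α x⟩)⁻¹ : ℝ) : ℂ) • s α x⟩ = 1 := by
  have h := hnu.pos _ _ (hs.ne_zero α x hx)
  rw [hnu.smul, Complex.norm_real, Real.norm_of_nonneg (inv_nonneg.2 h.le),
    inv_mul_cancel₀ h.ne']

/-- A system of sections of norm one has transition functions with values in the circle. -/
lemma exists_transition [IsManifold I ∞ M] (hs : L.IsFrameSystem 𝒰 s)
    {nu : L.toLineBundle.Total → ℝ} (hnu : L.toLineBundle.IsNorm nu)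
    (hone : ∀ α, ∀ x ∈ 𝒰.set α, nu ⟨x, s α x⟩ = 1) :
    ∃ g : ∀ α β, CircleFunctions τ (𝒰.double α β), ∀ α β, ∀ x : (𝒰.double α β).carrier,
      s α x = ((g α β x : Circle) : ℂ) • s β x := by
  have key : ∀ α β, ∃ f : CircleFunctions τ (𝒰.double α β), ∀ x : (𝒰.double α β).carrier,
      s α x = ((f x : Circle) : ℂ) • s β x := by
    intro α β
    have hr : ∀ x : (𝒰.double α β).carrier,
        ‖LineBundle.ratio (s α x) (s β x)‖ = 1 := by
      intro x
      have h := LineBundle.ratio_smul_self (s α x) (hs.ne_zero β x x.2.2)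
      have h1 := hone α x x.2.1
      rw [← h, hnu.smul, hone β x x.2.2, mul_one] at h1
      exact h1
    let f : (𝒰.double α β).carrier → Circle := fun x =>
      ⟨LineBundle.ratio (s α x) (s β x), mem_sphere_zero_iff_norm.2 (hr x)⟩
    have hf : ContMDiff I (𝓡 1) ∞ f := by
      apply contMDiff_circle_of_coe
      intro x
      have h1 : ContMDiffAt I 𝓘(ℝ, ℂ) ∞
          (fun y : M => LineBundle.ratio (s α y) (s β y)) (x : M) := by
        refine LineBundle.contMDiffAt_ratio (hs.contMDiffAt x.2.1) (hs.contMDiffAt x.2.2) ?_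
        filter_upwards [(𝒰.set β).isOpen.mem_nhds x.2.2] with y hy
        exact hs.ne_zero β y hy
      exact h1.comp x (contMDiff_subtype_val x)
    exact ⟨⟨f, hf⟩, fun x => (LineBundle.ratio_smul_self _ (hs.ne_zero β x x.2.2)).symm⟩
  choose g hg using key
  exact ⟨g, hg⟩

end IsFrameSystem

variable (L) in
/-- Every line bundle with a lift has an invariant system of nowhere zero smooth sections. -/
lemma exists_isFrameSystem : ∃ (𝒰 : RealCover τ) (s : 𝒰.Index → ∀ x, L.Fiber x),
    L.IsFrameSystem 𝒰 s := by
  let V : M → Opens M := fun x =>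
    ⟨(trivializationAt ℂ L.Fiber x).baseSet, (trivializationAt ℂ L.Fiber x).open_baseSet⟩
  let 𝒰 : RealCover τ :=
    RealCover.ofNhds τ V fun x => FiberBundle.mem_baseSet_trivializationAt ℂ L.Fiber x
  choose t ht htot using fun x y => L.exists_lift_eq y (L.toLineBundle.frame x (τ y))
  -- The frame with label `0` is free; equivariance forces the frame with label `1` to be its
  -- transport by the lift.
  let s : 𝒰.Index → ∀ x, L.Fiber x := fun α y =>
    if α.2 = 0 then L.toLineBundle.frame α.1 y else t α.1 y
  have h3 : ∀ c : ZMod 2, c = 0 ∨ c = 1 := by decide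
  refine ⟨𝒰, s, ?_, ?_, ?_⟩
  · rintro ⟨x, a⟩ y hy
    rcases h3 a with rfl | rfl
    · exact (LineBundle.contMDiffAt_frame (L := L.toLineBundle) (x := x) hy).contMDiffWithinAt
    · refine ContMDiffAt.contMDiffWithinAt ?_
      have h1 : (fun z => (⟨z, s (x, 1) z⟩ : L.toLineBundle.Total))
          = fun z => L.totalLift ⟨τ z, L.toLineBundle.frame x (τ z)⟩ := by
        funext z
        exact htot x z
      rw [h1]
      refine (L.contMDiff_totalLift _).comp y ?_
      exact ContMDiffAt.comp (g := fun z => (⟨z, L.toLineBundle.frame x z⟩ : L.toLineBundle.Total))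
        y (LineBundle.contMDiffAt_frame (L := L.toLineBundle) (x := x) hy) (τ.contMDiff_toFun y)
  · rintro ⟨x, a⟩ y hy
    rcases h3 a with rfl | rfl
    · exact LineBundle.frame_ne_zero (L := L.toLineBundle) (x := x) hy
    · intro h0
      apply LineBundle.frame_ne_zero (L := L.toLineBundle) (x := x) (y := τ y) hy
      rw [← ht x y]
      change L.lift y (s (x, 1) y) = 0
      rw [h0, map_zero]
  · rintro ⟨x, a⟩ y hy
    rcases h3 a with rfl | rfl
    · change t x (τ y) = L.lift y (L.toLineBundle.frame x y)
      apply L.total_mk_inj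
      rw [htot]
      have h1 : ∀ z, z = y → L.totalLift ⟨z, L.toLineBundle.frame x z⟩
          = L.totalLift ⟨y, L.toLineBundle.frame x y⟩ := by
        rintro z rfl
        rfl
      exact h1 _ (τ.involutive y)
    · exact (ht x y).symm

lemma isTransition_iff {𝒰 : RealCover τ} {g : ∀ α β, CircleFunctions τ (𝒰.double α β)} :
    L.IsTransition 𝒰 g ↔ ∃ s, L.IsFrameSystem 𝒰 s ∧
      ∀ α β, ∀ x : (𝒰.double α β).carrier, s α x = ((g α β x : Circle) : ℂ) • s β x := by
  constructor
  · rintro ⟨s, h1, h2, h3, h4⟩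
    exact ⟨s, ⟨h1, h2, h3⟩, h4⟩
  · rintro ⟨s, ⟨h1, h2, h3⟩, h4⟩
    exact ⟨s, h1, h2, h3, h4⟩

/-- Transition functions form an invariant cocycle. -/
lemma IsTransition.isInvariantCocycle {𝒰 : RealCover τ}
    {g : ∀ α β, CircleFunctions τ (𝒰.double α β)} (h : L.IsTransition 𝒰 g) :
    𝒰.IsInvariantCocycle (F := circleSheaf κ τ) (fun α β => Additive.ofMul (g α β)) := by
  obtain ⟨s, hs, hg⟩ := isTransition_iff.1 h
  apply isInvariantCocycle_of_pointwise
  · intro α β γ x h₁ h₂ h₃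
    apply Circle.ext
    apply LineBundle.smul_left_inj (hs.ne_zero γ x h₂.2)
    rw [Circle.coe_mul, mul_smul]
    exact (congrArg _ (hg β γ ⟨x, h₂⟩).symm).trans
      ((hg α β ⟨x, h₁⟩).symm.trans (hg α γ ⟨x, h₃⟩))
  · intro α β x hx hx'
    apply Circle.ext
    rw [LiftKind.coe_onCircle]
    apply LineBundle.smul_left_inj (hs.ne_zero β x hx.2)
    -- Applying the lift moves the identity to the fibre over `τ x`, where the frames with barred
    -- indices live.
    apply L.lift_injective
    have hκ : ∀ z : ℂ, κ.onComplex (κ.onComplex z) = z := by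
      intro z
      cases κ
      · rfl
      · exact Complex.conj_conj z
    rw [map_smulₛₗ, hκ, ← hs.equivariant β x hx.2]
    refine (hg (𝒰.bar α) (𝒰.bar β) ⟨τ x, hx'⟩).symm.trans ?_
    exact (hs.equivariant α x hx.1).trans (congrArg _ (hg α β ⟨x, hx⟩))

variable (L) in
theorem exists_hasClass [FiniteDimensional ℝ E] [IsManifold I ∞ M] [T2Space M]
    [SigmaCompactSpace M] : ∃ ξ, L.HasClass ξ := by
  obtain ⟨nu, hnu, hinv⟩ := L.exists_invariant_norm
  obtain ⟨𝒰, s, hs⟩ := L.exists_isFrameSystem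
  obtain ⟨g, hg⟩ := (hs.normalize hnu hinv).exists_transition hnu
    fun α x hx => hs.norm_normalize hnu hx
  have ht : L.IsTransition 𝒰 g := isTransition_iff.2 ⟨_, hs.normalize hnu hinv, hg⟩
  obtain ⟨ξ, hξ⟩ := ht.isInvariantCocycle.exists_represents
  exact ⟨ξ, 𝒰, g, ht, hξ⟩

/-- Transition functions can be realised by sections of norm one. -/
lemma IsTransition.exists_normalized {𝒰 : RealCover τ}
    {g : ∀ α β, CircleFunctions τ (𝒰.double α β)} (h : L.IsTransition 𝒰 g)
    {nu : L.toLineBundle.Total → ℝ} (hnu : L.toLineBundle.IsNorm nu)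
    (hinv : ∀ p, nu (L.totalLift p) = nu p) :
    ∃ s, L.IsFrameSystem 𝒰 s ∧ (∀ α, ∀ x ∈ 𝒰.set α, nu ⟨x, s α x⟩ = 1) ∧
      ∀ α β, ∀ x : (𝒰.double α β).carrier, s α x = ((g α β x : Circle) : ℂ) • s β x := by
  obtain ⟨s, hs, hg⟩ := isTransition_iff.1 h
  refine ⟨_, hs.normalize hnu hinv, fun α x hx => hs.norm_normalize hnu hx, fun α β x => ?_⟩
  -- Since `g α β` has absolute value one, both sections are rescaled by the same factor, and `g` is
  -- still the transition function.
  have h1 : nu ⟨x, s α x⟩ = nu ⟨x, s β x⟩ := by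
    rw [hg α β x, hnu.smul, Circle.norm_coe, one_mul]
  change _ • s α x = _ • (_ • s β x)
  rw [h1, smul_comm, ← hg α β x]

/-- A quotient of frames from two systems is a priori only `ℂ*`-valued. After normalising both by
one invariant norm it is circle-valued, so the two systems form one on the disjoint union of the
covers, whose class restricts to both given classes. -/
theorem HasClass.unique [FiniteDimensional ℝ E] [IsManifold I ∞ M] [T2Space M]
    [SigmaCompactSpace M] {ξ ξ' : equivariantCohomology τ 1 (circleSheaf κ τ)}
    (h : L.HasClass ξ) (h' : L.HasClass ξ') : ξ = ξ' := by
  obtain ⟨nu, hnu, hinv⟩ := L.exists_invariant_norm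
  obtain ⟨𝒰, g, hg, hξ⟩ := h
  obtain ⟨𝒰', g', hg', hξ'⟩ := h'
  obtain ⟨s, hs, hs1, hsg⟩ := hg.exists_normalized hnu hinv
  obtain ⟨s', hs', hs1', hsg'⟩ := hg'.exists_normalized hnu hinv
  let S : (𝒰.sum 𝒰').Index → ∀ x, L.Fiber x := Sum.elim s s'
  have hS : L.IsFrameSystem (𝒰.sum 𝒰') S := by
    refine ⟨?_, ?_, ?_⟩
    · rintro (α | α)
      · exact hs.contMDiffOn α
      · exact hs'.contMDiffOn α
    · rintro (α | α)
      · exact hs.ne_zero α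
      · exact hs'.ne_zero α
    · rintro (α | α)
      · exact hs.equivariant α
      · exact hs'.equivariant α
  have hS1 : ∀ α, ∀ x ∈ (𝒰.sum 𝒰').set α, nu ⟨x, S α x⟩ = 1 := by
    rintro (α | α)
    · exact hs1 α
    · exact hs1' α
  obtain ⟨G, hG⟩ := hS.exists_transition hnu hS1
  have hT : L.IsTransition (𝒰.sum 𝒰') G := isTransition_iff.2 ⟨S, hS, hG⟩
  obtain ⟨ξ₀, hξ₀⟩ := hT.isInvariantCocycle.exists_represents
  have e : ∀ α β, G (Sum.inl α) (Sum.inl β) = g α β := by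
    intro α β
    refine ContMDiffMap.ext fun x => Circle.ext ?_
    apply LineBundle.smul_left_inj (hs.ne_zero β x x.2.2)
    exact (hG (Sum.inl α) (Sum.inl β) x).symm.trans (hsg α β x)
  have e' : ∀ α β, G (Sum.inr α) (Sum.inr β) = g' α β := by
    intro α β
    refine ContMDiffMap.ext fun x => Circle.ext ?_
    apply LineBundle.smul_left_inj (hs'.ne_zero β x x.2.2)
    exact (hG (Sum.inr α) (Sum.inr β) x).symm.trans (hsg' α β x)
  have h1 : 𝒰.Represents (F := circleSheaf κ τ) (fun α β => Additive.ofMul (g α β)) ξ₀ := by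
    have := hξ₀.sum_inl
    have h2 : (fun α β => Additive.ofMul (G (Sum.inl α) (Sum.inl β)))
        = fun α β => Additive.ofMul (g α β) := funext fun α => funext fun β => congrArg _ (e α β)
    exact h2 ▸ this
  have h1' : 𝒰'.Represents (F := circleSheaf κ τ) (fun α β => Additive.ofMul (g' α β)) ξ₀ := by
    have := hξ₀.sum_inr
    have h2 : (fun α β => Additive.ofMul (G (Sum.inr α) (Sum.inr β)))
        = fun α β => Additive.ofMul (g' α β) := funext fun α => funext fun β => congrArg _ (e' α β)
    exact h2 ▸ this
  exact (hξ.unique h1).trans (h1'.unique hξ')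

theorem HasClass.of_isomorphic {L' : LiftedLineBundle.{u, v} κ τ}
    {ξ : equivariantCohomology τ 1 (circleSheaf κ τ)} (h : L.HasClass ξ)
    (hL : Isomorphic L L') : L'.HasClass ξ := by
  obtain ⟨𝒰, g, hg, hξ⟩ := h
  obtain ⟨s, hs, hsg⟩ := isTransition_iff.1 hg
  obtain ⟨e, he, -, hc⟩ := hL
  refine ⟨𝒰, g, isTransition_iff.2 ⟨fun α x => e x (s α x), ⟨fun α => ?_, fun α x hx => ?_,
    fun α x hx => ?_⟩, fun α β x => ?_⟩, hξ⟩
  · exact he.comp_contMDiffOn (hs.contMDiffOn α)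
  · exact (e x).map_ne_zero_iff.2 (hs.ne_zero α x hx)
  · rw [hs.equivariant α x hx, hc]
  · exact (congrArg (e x) (hsg α β x)).trans (map_smul _ _ _)

end LiftedLineBundle

end LiftedBundles
-- Bundles with the same class are isomorphic
lemma LiftKind.contDiff_onComplex (κ : LiftKind) : ContDiff ℝ ∞ (fun z : ℂ => κ.onComplex z) := by
  cases κ
  · exact contDiff_id
  · exact Complex.conjCLE.contDiff

section Comparison

variable {E : Type*} [NormedAddCommGroup E] [NormedSpace ℝ E]
  {H : Type*} [TopologicalSpace H] {I : ModelWithCorners ℝ E H}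
  {M : Type u} [TopologicalSpace M] [ChartedSpace H M]
  {κ : LiftKind} {τ : SmoothInvolution I M}

namespace LineBundle

/-- A fibrewise semilinear map of line bundles is smooth if it maps smooth local frames to smooth
local sections. -/
lemma contMDiff_of_frames {L L' : LineBundle.{u, v} I M} (κ : LiftKind) {b : M → M}
    (hb : ContMDiff I I ∞ b) (φ : ∀ x, L.Fiber x →ₛₗ[κ.onComplex] L'.Fiber (b x))
    (h : ∀ x, ∃ (s : ∀ y, L.Fiber y) (s' : ∀ y, L'.Fiber y),
      ContMDiffAt I (I.prod 𝓘(ℝ, ℂ)) ∞ (fun y => (⟨y, s y⟩ : L.Total)) x ∧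
      ContMDiffAt I (I.prod 𝓘(ℝ, ℂ)) ∞ (fun y => (⟨y, s' y⟩ : L'.Total)) (b x) ∧
      ∀ᶠ y in nhds x, s y ≠ 0 ∧ φ y (s y) = s' (b y)) :
    ContMDiff (I.prod 𝓘(ℝ, ℂ)) (I.prod 𝓘(ℝ, ℂ)) ∞
      (fun p : L.Total => (⟨b p.1, φ p.1 p.2⟩ : L'.Total)) := by
  intro p
  obtain ⟨s, s', hs, hs', hev⟩ := h p.1
  have hproj : ContMDiffAt (I.prod 𝓘(ℝ, ℂ)) I ∞ (fun q : L.Total => q.1) p :=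
    Bundle.contMDiffAt_proj L.Fiber
  have hev' : ∀ᶠ q : L.Total in nhds p, s q.1 ≠ 0 ∧ φ q.1 (s q.1) = s' (b q.1) :=
    hproj.continuousAt.eventually hev
  -- Near `p` a vector is its ratio to the frame times the frame, so its image is the conjugated or
  -- unchanged ratio times the smooth section `s'`.
  have hr : ContMDiffAt (I.prod 𝓘(ℝ, ℂ)) 𝓘(ℝ, ℂ) ∞ (fun q : L.Total => ratio q.2 (s q.1)) p :=
    contMDiffAt_ratio (w := fun q : L.Total => q.2) (v := fun q : L.Total => s q.1)
      contMDiffAt_id (hs.comp p hproj) (hev'.mono fun q hq => hq.1)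
  have hκr : ContMDiffAt (I.prod 𝓘(ℝ, ℂ)) 𝓘(ℝ, ℂ) ∞
      (fun q : L.Total => κ.onComplex (ratio q.2 (s q.1))) p :=
    κ.contDiff_onComplex.contDiffAt.contMDiffAt.comp p hr
  have hs'' : ContMDiffAt (I.prod 𝓘(ℝ, ℂ)) (I.prod 𝓘(ℝ, ℂ)) ∞
      (fun q : L.Total => (⟨b q.1, s' (b q.1)⟩ : L'.Total)) p :=
    ContMDiffAt.comp (g := fun y => (⟨y, s' y⟩ : L'.Total)) p hs'
      ((hb p.1).comp p hproj)
  refine (contMDiffAt_smul hκr hs'').congr_of_eventuallyEq ?_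
  filter_upwards [hev'] with q hq
  rw [← hq.2, ← map_smulₛₗ, ratio_smul_self _ hq.1]

lemma ratio_smul {L : LineBundle.{u, v} I M} {x : M} (a : ℂ) (w : L.Fiber x) {z : L.Fiber x}
    (hz : z ≠ 0) : ratio (a • w) z = a * ratio w z := by
  rw [ratio_eq_iff hz, mul_smul, ratio_smul_self w hz]

lemma ratio_self {L : LineBundle.{u, v} I M} {x : M} {z : L.Fiber x} (hz : z ≠ 0) :
    ratio z z = 1 := by
  rw [ratio_eq_iff hz, one_smul]

/-- The isomorphism of two fibres of line bundles which maps a given nonzero vector to another. -/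
noncomputable def fiberEquiv {L L' : LineBundle.{u, v} I M} {x : M} (z : L.Fiber x)
    (z' : L'.Fiber x) (hz : z ≠ 0) (hz' : z' ≠ 0) : L.Fiber x ≃ₗ[ℂ] L'.Fiber x where
  toFun w := ratio w z • z'
  invFun w := ratio w z' • z
  map_add' w₁ w₂ := by
    have h : ratio (w₁ + w₂) z = ratio w₁ z + ratio w₂ z := by
      rw [ratio_eq_iff hz, add_smul, ratio_smul_self _ hz, ratio_smul_self _ hz]
    rw [h, add_smul]
  map_smul' a w := by
    rw [ratio_smul a w hz, mul_smul]
    rfl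
  left_inv w := by
    change ratio (ratio w z • z') z' • z = w
    rw [ratio_smul _ _ hz', ratio_self hz', mul_one, ratio_smul_self _ hz]
  right_inv w := by
    change ratio (ratio w z' • z) z • z' = w
    rw [ratio_smul _ _ hz, ratio_self hz, mul_one, ratio_smul_self _ hz']

lemma fiberEquiv_self {L L' : LineBundle.{u, v} I M} {x : M} (z : L.Fiber x)
    (z' : L'.Fiber x) (hz : z ≠ 0) (hz' : z' ≠ 0) : fiberEquiv z z' hz hz' z = z' := by
  change ratio z z • z' = z'
  rw [ratio_self hz, one_smul]

end LineBundle

namespace LiftedLineBundle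

open LineBundle

variable {L L' : LiftedLineBundle.{u, v} κ τ}

/-- Line bundles with the same class are isomorphic. -/
theorem HasClass.isomorphic {ξ : equivariantCohomology τ 1 (circleSheaf κ τ)}
    (h : L.HasClass ξ) (h' : L'.HasClass ξ) : Isomorphic L L' := by
  obtain ⟨𝒰, g, hg, hξ⟩ := h
  obtain ⟨𝒰', g', hg', hξ'⟩ := h'
  obtain ⟨s, hs, hsg⟩ := isTransition_iff.1 hg
  obtain ⟨s', hs', hsg'⟩ := isTransition_iff.1 hg'
  obtain ⟨k₀, hk, hkinv⟩ := hξ.exists_comparison hξ'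
  let k : ∀ α α', CircleFunctions τ (RealCover.inter 𝒰 𝒰' α α') := fun α α' => (k₀ α α').toMul
  have hk1 : ∀ α β α' β' x (hα : x ∈ 𝒰.set α) (hβ : x ∈ 𝒰.set β) (hα' : x ∈ 𝒰'.set α')
      (hβ' : x ∈ 𝒰'.set β'), k α α' ⟨x, hα, hα'⟩ * g' α' β' ⟨x, hα', hβ'⟩
        = g α β ⟨x, hα, hβ⟩ * k β β' ⟨x, hβ, hβ'⟩ := by
    intro α β α' β' x hα hβ hα' hβ'
    let Z : ActionOpens τ := ⟨𝒰.set α ⊓ 𝒰.set β ⊓ (𝒰'.set α' ⊓ 𝒰'.set β')⟩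
    have hx : x ∈ Z.carrier := ⟨⟨hα, hβ⟩, hα', hβ'⟩
    have h := hk α β α' β' Z (ActionOpens.incl fun y hy => ⟨hy.1.1, hy.2.1⟩)
      (ActionOpens.incl fun y hy => ⟨hy.1.2, hy.2.2⟩) (ActionOpens.incl fun y hy => hy.1)
      (ActionOpens.incl fun y hy => hy.2) rfl rfl rfl rfl
    exact congrArg (fun f : Additive (CircleFunctions τ Z) => f.toMul ⟨x, hx⟩) h
  have hk2 : ∀ α α' x (hα : x ∈ 𝒰.set α) (hα' : x ∈ 𝒰'.set α'),
      κ.onCircle (k (𝒰.bar α) (𝒰'.bar α') ⟨τ x, 𝒰.map_mem α x hα, 𝒰'.map_mem α' x hα'⟩)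
        = k α α' ⟨x, hα, hα'⟩ := by
    intro α α' x hα hα'
    exact congrArg (fun f : Additive (CircleFunctions τ (RealCover.inter 𝒰 𝒰' α α')) =>
      f.toMul ⟨x, hα, hα'⟩) (hkinv α α')
  choose i hi using 𝒰.covers
  choose i' hi' using 𝒰'.covers
  -- The isomorphism sends `s α` to `k α α' • s' α'`. It is defined with arbitrarily chosen indices
  -- at each point; `he` shows that all indices give the same map, by the comparison identity `hk1`.
  let e : ∀ x, L.Fiber x ≃ₗ[ℂ] L'.Fiber x := fun x =>
    fiberEquiv (s (i x) x) (((k (i x) (i' x) ⟨x, hi x, hi' x⟩ : Circle) : ℂ) • s' (i' x) x)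
      (hs.ne_zero _ _ (hi x)) (smul_ne_zero (Circle.coe_ne_zero _) (hs'.ne_zero _ _ (hi' x)))
  have he : ∀ α α' x (hα : x ∈ 𝒰.set α) (hα' : x ∈ 𝒰'.set α'),
      e x (s α x) = ((k α α' ⟨x, hα, hα'⟩ : Circle) : ℂ) • s' α' x := by
    intro α α' x hα hα'
    have h1 := hsg α (i x) ⟨x, hα, hi x⟩
    have h2 := hsg' α' (i' x) ⟨x, hα', hi' x⟩
    have h3 : e x (s (i x) x)
        = ((k (i x) (i' x) ⟨x, hi x, hi' x⟩ : Circle) : ℂ) • s' (i' x) x := fiberEquiv_self _ _ _ _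
    have h4 := congrArg (fun z : Circle => (z : ℂ))
      (hk1 α (i x) α' (i' x) x hα (hi x) hα' (hi' x))
    have h5 : s' α' x = ((g' α' (i' x) ⟨x, hα', hi' x⟩ : Circle) : ℂ) • s' (i' x) x := h2
    have h6 : s α x = ((g α (i x) ⟨x, hα, hi x⟩ : Circle) : ℂ) • s (i x) x := h1
    rw [h6, map_smul, h3, h5, smul_smul, smul_smul]
    exact congrArg (· • s' (i' x) x) h4.symm
  have hsmooth : ∀ α α' x, x ∈ 𝒰.set α → x ∈ 𝒰'.set α' →
      ContMDiffAt I (I.prod 𝓘(ℝ, ℂ)) ∞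
        (fun y => (⟨y, e y (s α y)⟩ : L'.toLineBundle.Total)) x := by
    intro α α' x hα hα'
    classical
    -- An extension by zero, used only near points of the open intersection.
    let f : M → ℂ := fun y => if h : y ∈ 𝒰.set α ⊓ 𝒰'.set α' then (k α α' ⟨y, h⟩ : Circle) else 0
    have hf : ContMDiffAt I 𝓘(ℝ, ℂ) ∞ f x := by
      rw [← contMDiffAt_subtype_iff
        (x := (⟨x, hα, hα'⟩ : (RealCover.inter 𝒰 𝒰' α α').carrier))]
      refine (contMDiff_coe_circle.comp (k α α').contMDiff _).congr_of_eventuallyEq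
        (Filter.Eventually.of_forall fun y => ?_)
      exact dif_pos y.2
    refine (contMDiffAt_smul hf (hs'.contMDiffAt hα')).congr_of_eventuallyEq ?_
    filter_upwards [(𝒰.set α ⊓ 𝒰'.set α').isOpen.mem_nhds ⟨hα, hα'⟩] with y hy
    have h1 : f y = (k α α' ⟨y, hy⟩ : Circle) := dif_pos hy
    rw [h1, he α α' y hy.1 hy.2]
  have hne : ∀ α x, x ∈ 𝒰.set α → e x (s α x) ≠ 0 :=
    fun α x hx => (e x).map_ne_zero_iff.2 (hs.ne_zero α x hx)
  refine ⟨e, ?_, ?_, ?_⟩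
  · refine contMDiff_of_frames LiftKind.linear (b := fun x => x) contMDiff_id
      (fun x => (e x).toLinearMap) fun x =>
      ⟨s (i x), fun y => e y (s (i x) y), hs.contMDiffAt (hi x), hsmooth _ _ _ (hi x) (hi' x), ?_⟩
    filter_upwards [(𝒰.set (i x)).isOpen.mem_nhds (hi x)] with y hy
    exact ⟨hs.ne_zero _ _ hy, rfl⟩
  · refine contMDiff_of_frames LiftKind.linear (b := fun x => x) contMDiff_id
      (fun x => (e x).symm.toLinearMap) fun x =>
      ⟨fun y => e y (s (i x) y), s (i x), hsmooth _ _ _ (hi x) (hi' x), hs.contMDiffAt (hi x), ?_⟩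
    filter_upwards [(𝒰.set (i x)).isOpen.mem_nhds (hi x)] with y hy
    exact ⟨hne _ _ hy, (e y).symm_apply_apply _⟩
  · intro x w
    -- Both composites are semilinear of the same kind, so they are compared on the frame vector
    -- alone, where their equality is the invariance `hk2` of `k`.
    have h0 := hs.ne_zero _ _ (hi x)
    have h1 : e x (s (i x) x) = _ := he (i x) (i' x) x (hi x) (hi' x)
    have h2 := he (𝒰.bar (i x)) (𝒰'.bar (i' x)) (τ x) (𝒰.map_mem _ _ (hi x))
      (𝒰'.map_mem _ _ (hi' x))
    rw [← ratio_smul_self w h0, map_smulₛₗ, map_smul, map_smulₛₗ, map_smulₛₗ, h1, map_smulₛₗ,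
      ← hs.equivariant _ _ (hi x), ← hs'.equivariant _ _ (hi' x)]
    refine congrArg _ (h2.trans (congrArg (· • s' (𝒰'.bar (i' x)) (τ x)) ?_))
    rw [← hk2 (i x) (i' x) x (hi x) (hi' x), LiftKind.coe_onCircle]
    cases κ
    · rfl
    · exact (Complex.conj_conj _).symm

end LiftedLineBundle

end Comparison
-- Gluing a line bundle from an invariant cocycle
section Construction

variable {E : Type*} [NormedAddCommGroup E] [NormedSpace ℝ E]
  {H : Type*} [TopologicalSpace H] {I : ModelWithCorners ℝ E H}
  {M : Type u} [TopologicalSpace M] [ChartedSpace H M]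
  {κ : LiftKind} {τ : SmoothInvolution I M}

/-- Complex valued functions which form an invariant multiplicative cocycle on a Real cover. -/
structure GluingData (κ : LiftKind) (𝒰 : RealCover τ) where
  toFun : 𝒰.Index → 𝒰.Index → M → ℂ
  contMDiffOn : ∀ α β, ContMDiffOn I 𝓘(ℝ, ℂ) ∞ (toFun α β) (𝒰.set α ∩ 𝒰.set β)
  self_eq_one : ∀ α, ∀ x ∈ 𝒰.set α, toFun α α x = 1
  mul_eq : ∀ α β γ, ∀ x ∈ 𝒰.set α, x ∈ 𝒰.set β → x ∈ 𝒰.set γ →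
    toFun α β x * toFun β γ x = toFun α γ x
  equivariant : ∀ α β, ∀ x ∈ 𝒰.set α, x ∈ 𝒰.set β →
    κ.onComplex (toFun α β x) = toFun (𝒰.bar α) (𝒰.bar β) (τ x)

namespace GluingData

variable {𝒰 : RealCover τ} (c : GluingData κ 𝒰)

/-- The index of a member of the cover which contains `x`. -/
noncomputable def idx (_c : GluingData κ 𝒰) (x : M) : 𝒰.Index := (𝒰.covers x).choose

lemma mem_idx (x : M) : x ∈ 𝒰.set (c.idx x) := (𝒰.covers x).choose_spec

/-- The fibres of the line bundle glued from a cocycle. -/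
def Fiber (_c : GluingData κ 𝒰) (_x : M) : Type v := ULift.{v} ℂ

instance (x : M) : AddCommGroup (Fiber.{u, v} c x) := inferInstanceAs (AddCommGroup (ULift ℂ))

noncomputable instance (x : M) : Module ℂ (Fiber.{u, v} c x) :=
  inferInstanceAs (Module ℂ (ULift ℂ))

/-- The coordinate on a fibre given by the member `β` of the cover. -/
noncomputable def chart (β : 𝒰.Index) (x : M) : Fiber.{u, v} c x →ₗ[ℂ] ℂ where
  -- The number underlying `w` is its coordinate in the chosen member `idx x`; the cocycle converts
  -- it to the member `β`.
  toFun w := c.toFun (c.idx x) β x * ULift.down w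
  map_add' _ _ := mul_add _ _ _
  map_smul' a _ := mul_left_comm _ a _

/-- The vector with a given coordinate in the member `β` of the cover. -/
noncomputable def vec (β : 𝒰.Index) (x : M) (z : ℂ) : Fiber.{u, v} c x :=
  ULift.up (c.toFun β (c.idx x) x * z)

/-- The arbitrary index `idx x` cancels by the cocycle identity. -/
lemma chart_vec {α β : 𝒰.Index} {x : M} (hα : x ∈ 𝒰.set α) (hβ : x ∈ 𝒰.set β) (z : ℂ) :
    c.chart β x (vec.{u, v} c α x z) = c.toFun α β x * z := by
  change c.toFun (c.idx x) β x * (c.toFun α (c.idx x) x * z) = _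
  rw [← c.mul_eq α (c.idx x) β x hα (c.mem_idx x) hβ]
  ring

lemma chart_vec_self {α : 𝒰.Index} {x : M} (hα : x ∈ 𝒰.set α) (z : ℂ) :
    c.chart α x (vec.{u, v} c α x z) = z := by
  rw [chart_vec c hα hα, c.self_eq_one α x hα, one_mul]

lemma vec_chart {β : 𝒰.Index} {x : M} (hβ : x ∈ 𝒰.set β) (w : Fiber.{u, v} c x) :
    c.vec β x (c.chart β x w) = w := by
  apply ULift.down_injective
  change c.toFun β (c.idx x) x * (c.toFun (c.idx x) β x * ULift.down w) = ULift.down w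
  rw [← mul_assoc, mul_comm (c.toFun β (c.idx x) x),
    c.mul_eq _ _ _ x (c.mem_idx x) hβ (c.mem_idx x), c.self_eq_one _ x (c.mem_idx x), one_mul]

/-- The trivialization of the glued line bundle over the member `β` of the cover. -/
noncomputable def pretrivialization (β : 𝒰.Index) :
    Bundle.Pretrivialization ℂ (Bundle.TotalSpace.proj : Bundle.TotalSpace ℂ (Fiber.{u, v} c) → M) where
  toFun p := (p.1, c.chart β p.1 p.2)
  invFun q := ⟨q.1, c.vec β q.1 q.2⟩
  source := Bundle.TotalSpace.proj ⁻¹' (𝒰.set β)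
  target := (𝒰.set β : Set M) ×ˢ Set.univ
  map_source' _ hp := ⟨hp, trivial⟩
  map_target' _ hq := hq.1
  left_inv' p hp := congrArg (Bundle.TotalSpace.mk p.1) (c.vec_chart hp p.2)
  right_inv' q hq := Prod.ext rfl (c.chart_vec_self hq.1 q.2)
  open_target := (𝒰.set β).isOpen.prod isOpen_univ
  baseSet := 𝒰.set β
  open_baseSet := (𝒰.set β).isOpen
  source_eq := rfl
  target_eq := rfl
  proj_toFun _ _ := rfl

/-- Induced from the preferred pretrivialization, so that the inducing condition of the prebundle
holds by definition. -/
noncomputable instance (x : M) : TopologicalSpace (Fiber.{u, v} c x) :=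
  TopologicalSpace.induced (c.pretrivialization (c.idx x) ∘ Bundle.TotalSpace.mk x) inferInstance

lemma pretrivialization_symm {α β : 𝒰.Index} {x : M} (hα : x ∈ 𝒰.set α) (hβ : x ∈ 𝒰.set β)
    (z : ℂ) : (pretrivialization.{u, v} c β ⟨x, (c.pretrivialization α).symm x z⟩).2
      = c.toFun α β x * z := by
  rw [Bundle.Pretrivialization.mk_symm _ (show x ∈ (c.pretrivialization α).baseSet from hα)]
  exact c.chart_vec hα hβ z

/-- The glued line bundle as a vector prebundle, over the real or the complex numbers. -/
noncomputable def prebundle (R : Type) [NontriviallyNormedField R] [NormedAlgebra R ℂ]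
    [∀ x, Module R (Fiber.{u, v} c x)] [∀ x, IsScalarTower R ℂ (Fiber.{u, v} c x)] :
    VectorPrebundle R ℂ (Fiber.{u, v} c) where
  pretrivializationAtlas := Set.range c.pretrivialization
  pretrivialization_linear' := by
    rintro _ ⟨β, rfl⟩
    exact ⟨fun x _ => ⟨map_add (c.chart β x), (c.chart β x).map_smul_of_tower⟩⟩
  pretrivializationAt x := c.pretrivialization (c.idx x)
  mem_base_pretrivializationAt := c.mem_idx
  pretrivialization_mem_atlas x := ⟨_, rfl⟩
  exists_coordChange := by
    rintro _ ⟨α, rfl⟩ _ ⟨β, rfl⟩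
    refine ⟨fun x => ContinuousLinearMap.mul R ℂ (c.toFun α β x), ?_, ?_⟩
    · exact (ContinuousLinearMap.mul R ℂ).continuous.comp_continuousOn
        (c.contMDiffOn α β).continuousOn
    · intro x hx z
      exact (c.pretrivialization_symm hx.1 hx.2 z).symm
  totalSpaceMk_isInducing x := ⟨rfl⟩

instance isContMDiff_prebundle : (prebundle.{u, v} c ℝ).IsContMDiff I ∞ where
  exists_contMDiffCoordChange := by
    rintro _ ⟨α, rfl⟩ _ ⟨β, rfl⟩
    refine ⟨fun x => ContinuousLinearMap.mul ℝ ℂ (c.toFun α β x), ?_, ?_⟩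
    · exact (ContinuousLinearMap.mul ℝ ℂ).contDiff.contMDiff.comp_contMDiffOn (c.contMDiffOn α β)
    · intro x hx z
      exact (c.pretrivialization_symm hx.1 hx.2 z).symm

noncomputable instance : TopologicalSpace (Bundle.TotalSpace ℂ (Fiber.{u, v} c)) :=
  (c.prebundle ℝ).totalSpaceTopology

noncomputable instance : FiberBundle ℂ (Fiber.{u, v} c) := (c.prebundle ℝ).toFiberBundle

/-- The line bundle glued from a cocycle. -/
noncomputable def lineBundle : LineBundle.{u, v} I M where
  Fiber := c.Fiber
  topTotal := inferInstance
  topFiber := inferInstance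
  fiberBundle := inferInstance
  -- The real and complex prebundles have the same pretrivializations, so their total space
  -- topologies and fibre bundle structures agree definitionally.
  complexBundle := (c.prebundle ℂ).toVectorBundle
  realBundle := (c.prebundle ℝ).toVectorBundle
  smooth := (c.prebundle ℝ).contMDiffVectorBundle I

end GluingData
end Construction
section Construction

variable {E : Type*} [NormedAddCommGroup E] [NormedSpace ℝ E]
  {H : Type*} [TopologicalSpace H] {I : ModelWithCorners ℝ E H}
  {M : Type u} [TopologicalSpace M] [ChartedSpace H M]
  {κ : LiftKind} {τ : SmoothInvolution I M}

namespace GluingData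

variable {𝒰 : RealCover τ} (c : GluingData κ 𝒰)

/-- The chart of every member `β` belongs to the atlas of the smooth bundle, so smoothness may be
tested in any of them, and the choice `idx` plays no role. -/
lemma contMDiffAt_iff_chart {EN : Type*} [NormedAddCommGroup EN] [NormedSpace ℝ EN] {HN : Type*}
    [TopologicalSpace HN] {J : ModelWithCorners ℝ EN HN} {N : Type*} [TopologicalSpace N]
    [ChartedSpace HN N] {f : N → (lineBundle.{u, v} c).Total} {n : N} {β : 𝒰.Index}
    (hn : (f n).1 ∈ 𝒰.set β) :
    ContMDiffAt J (I.prod 𝓘(ℝ, ℂ)) ∞ f n ↔ ContMDiffAt J I ∞ (fun m => (f m).1) n ∧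
      ContMDiffAt J 𝓘(ℝ, ℂ) ∞ (fun m => c.chart β (f m).1 (f m).2) n := by
  have hβ : c.pretrivialization β ∈ (prebundle.{u, v} c ℝ).pretrivializationAtlas := ⟨β, rfl⟩
  let e : Bundle.Trivialization ℂ
      (Bundle.TotalSpace.proj : Bundle.TotalSpace ℂ (lineBundle.{u, v} c).Fiber → M) :=
    (c.prebundle ℝ).trivializationOfMemPretrivializationAtlas hβ
  have : MemTrivializationAtlas e := ⟨⟨c.pretrivialization β, hβ, rfl⟩⟩
  exact e.contMDiffAt_iff (e.mem_source.2 hn)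

/-- The section of the glued line bundle over the member `β` of the cover. -/
noncomputable def frame (β : 𝒰.Index) (x : M) : (lineBundle.{u, v} c).Fiber x := c.vec β x 1

lemma chart_frame {α β : 𝒰.Index} {x : M} (hα : x ∈ 𝒰.set α) (hβ : x ∈ 𝒰.set β) :
    c.chart β x (frame.{u, v} c α x) = c.toFun α β x := by
  unfold frame
  rw [c.chart_vec hα hβ, mul_one]

lemma chart_injective {β : 𝒰.Index} {x : M} (hβ : x ∈ 𝒰.set β) :
    Function.Injective (c.chart β x : Fiber.{u, v} c x → ℂ) := by
  intro w w' h
  rw [← c.vec_chart hβ w, h, c.vec_chart hβ]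

lemma frame_ne_zero {β : 𝒰.Index} {x : M} (hβ : x ∈ 𝒰.set β) : frame.{u, v} c β x ≠ 0 := by
  intro h
  have h1 := chart_frame.{u, v} c hβ hβ
  rw [h, c.self_eq_one β x hβ] at h1
  exact zero_ne_one ((map_zero (c.chart β x)).symm.trans h1)

lemma frame_eq_smul {α β : 𝒰.Index} {x : M} (hα : x ∈ 𝒰.set α) (hβ : x ∈ 𝒰.set β) :
    frame.{u, v} c α x = c.toFun α β x • frame.{u, v} c β x := by
  apply c.chart_injective hβ
  rw [chart_frame c hα hβ]
  refine Eq.trans ?_ (map_smul (c.chart β x) _ _).symm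
  rw [chart_frame c hβ hβ, c.self_eq_one β x hβ, smul_eq_mul, mul_one]

lemma contMDiffAt_frame {β : 𝒰.Index} {x : M} (hβ : x ∈ 𝒰.set β) :
    ContMDiffAt I (I.prod 𝓘(ℝ, ℂ)) ∞
      (fun y => (⟨y, c.frame β y⟩ : (lineBundle.{u, v} c).Total)) x := by
  refine (c.contMDiffAt_iff_chart (β := β) hβ).2 ⟨contMDiffAt_id, ?_⟩
  refine (contMDiffAt_const (c := (1 : ℂ))).congr_of_eventuallyEq ?_
  filter_upwards [(𝒰.set β).isOpen.mem_nhds hβ] with y hy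
  exact (c.chart_frame hy hy).trans (c.self_eq_one β y hy)

/-- The lift of the involution to the glued line bundle. -/
noncomputable def lift (x : M) :
    (lineBundle.{u, v} c).Fiber x →ₛₗ[κ.onComplex] (lineBundle.{u, v} c).Fiber (τ x) where
  toFun w := κ.onComplex (c.chart (c.idx x) x w) • c.frame (𝒰.bar (c.idx x)) (τ x)
  map_add' w w' := by
    have h : c.chart (c.idx x) x (w + w') = c.chart (c.idx x) x w + c.chart (c.idx x) x w' :=
      map_add _ _ _
    rw [h, map_add, add_smul]
  map_smul' a w := by
    have h : c.chart (c.idx x) x (a • w) = a * c.chart (c.idx x) x w := map_smul _ _ _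
    rw [h, map_mul, mul_smul]

/-- The lift is defined through the chosen index; equivariance of the cocycle makes the same formula
hold for every index. -/
lemma lift_frame {α : 𝒰.Index} {x : M} (hα : x ∈ 𝒰.set α) :
    c.lift x (frame.{u, v} c α x) = frame.{u, v} c (𝒰.bar α) (τ x) := by
  change κ.onComplex (c.chart (c.idx x) x (c.frame α x)) • c.frame (𝒰.bar (c.idx x)) (τ x) = _
  rw [c.chart_frame hα (c.mem_idx x), c.equivariant _ _ x hα (c.mem_idx x)]
  exact (c.frame_eq_smul (𝒰.map_mem _ x hα) (𝒰.map_mem _ x (c.mem_idx x))).symm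

lemma lift_lift (x : M) (w : (lineBundle.{u, v} c).Fiber x) :
    (⟨τ (τ x), c.lift (τ x) (c.lift x w)⟩ : (lineBundle.{u, v} c).Total) = ⟨x, w⟩ := by
  have hx := c.mem_idx x
  have h0 := frame_ne_zero.{u, v} c hx
  have hκ : ∀ z : ℂ, κ.onComplex (κ.onComplex z) = z := by
    intro z
    cases κ
    · rfl
    · exact Complex.conj_conj z
  -- As `τ (τ x)` equals `x` only propositionally, the vector is extended along the frame to a
  -- variable point `y`.
  have h1 : ∀ y, y = x → (⟨y, LineBundle.ratio w (c.frame (c.idx x) x) • c.frame (c.idx x) y⟩ :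
      (lineBundle.{u, v} c).Total) = ⟨x, w⟩ := by
    rintro y rfl
    rw [LineBundle.ratio_smul_self w h0]
  rw [← h1 _ (τ.involutive x)]
  refine congrArg (Bundle.TotalSpace.mk (τ (τ x))) ?_
  conv_lhs => rw [← LineBundle.ratio_smul_self w h0]
  rw [map_smulₛₗ, map_smulₛₗ, hκ, c.lift_frame hx, c.lift_frame (𝒰.map_mem _ x hx),
    𝒰.bar_involutive]

/-- The line bundle glued from an invariant cocycle, with its lift of the involution. -/
noncomputable def liftedLineBundle : LiftedLineBundle.{u, v} κ τ where
  toLineBundle := c.lineBundle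
  lift := c.lift
  contMDiff_lift := by
    refine LineBundle.contMDiff_of_frames κ τ.contMDiff_toFun c.lift fun x =>
      ⟨c.frame (c.idx x), c.frame (𝒰.bar (c.idx x)), c.contMDiffAt_frame (c.mem_idx x),
        c.contMDiffAt_frame (𝒰.map_mem _ x (c.mem_idx x)), ?_⟩
    filter_upwards [(𝒰.set (c.idx x)).isOpen.mem_nhds (c.mem_idx x)] with y hy
    exact ⟨c.frame_ne_zero hy, c.lift_frame hy⟩
  lift_lift p := c.lift_lift p.1 p.2

lemma isFrameSystem_frame : (liftedLineBundle.{u, v} c).IsFrameSystem 𝒰 c.frame where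
  contMDiffOn _ _ hx := (c.contMDiffAt_frame hx).contMDiffWithinAt
  ne_zero _ _ hx := c.frame_ne_zero hx
  equivariant _ _ hx := (c.lift_frame hx).symm

end GluingData

/-! ### Every class comes from a bundle, and the classification -/

namespace GluingData

/-- The gluing data defined by an invariant cocycle of circle valued functions. -/
noncomputable def ofCocycle {𝒰 : RealCover τ} (g : ∀ α β, CircleFunctions τ (𝒰.double α β))
    (hg : 𝒰.IsInvariantCocycle (F := circleSheaf κ τ) (fun α β => Additive.ofMul (g α β))) :
    GluingData κ 𝒰 :=
  open Classical in
  have happly : ∀ α β x (h : x ∈ 𝒰.set α ⊓ 𝒰.set β),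
      (if h : x ∈ 𝒰.set α ⊓ 𝒰.set β then ((g α β ⟨x, h⟩ : Circle) : ℂ) else 0)
        = (g α β ⟨x, h⟩ : Circle) := fun _ _ _ h => dif_pos h
  { toFun := fun α β x =>
      if h : x ∈ 𝒰.set α ⊓ 𝒰.set β then ((g α β ⟨x, h⟩ : Circle) : ℂ) else 0
    contMDiffOn := by
      intro α β x hx
      refine ContMDiffAt.contMDiffWithinAt ?_
      rw [← contMDiffAt_subtype_iff (x := (⟨x, hx⟩ : (𝒰.double α β).carrier))]
      exact (contMDiff_coe_circle.comp (g α β).contMDiff _).congr_of_eventuallyEq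
        (Filter.Eventually.of_forall fun y => dif_pos y.2)
    self_eq_one := by
      intro α x hx
      have h := (pointwise_of_isInvariantCocycle hg).1 α α α x ⟨hx, hx⟩ ⟨hx, hx⟩ ⟨hx, hx⟩
      rw [happly α α x ⟨hx, hx⟩]
      -- The cocycle identity with three equal indices says that `g α α` is idempotent, hence one.
      exact congrArg (fun z : Circle => (z : ℂ)) (mul_eq_left.1 h)
    mul_eq := by
      intro α β γ x hα hβ hγ
      rw [happly α β x ⟨hα, hβ⟩, happly β γ x ⟨hβ, hγ⟩, happly α γ x ⟨hα, hγ⟩]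
      exact congrArg (fun z : Circle => (z : ℂ))
        ((pointwise_of_isInvariantCocycle hg).1 α β γ x ⟨hα, hβ⟩ ⟨hβ, hγ⟩ ⟨hα, hγ⟩)
    equivariant := by
      intro α β x hα hβ
      have h := (pointwise_of_isInvariantCocycle hg).2 α β x ⟨hα, hβ⟩
        ⟨𝒰.map_mem α x hα, 𝒰.map_mem β x hβ⟩
      rw [happly α β x ⟨hα, hβ⟩, happly _ _ _ ⟨𝒰.map_mem α x hα, 𝒰.map_mem β x hβ⟩]
      rw [← LiftKind.coe_onCircle]
      refine congrArg (fun z : Circle => (z : ℂ)) ((congrArg κ.onCircle h.symm).trans ?_)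
      cases κ
      · rfl
      · exact inv_inv _ }

lemma ofCocycle_apply {𝒰 : RealCover τ} {g : ∀ α β, CircleFunctions τ (𝒰.double α β)}
    (hg : 𝒰.IsInvariantCocycle (F := circleSheaf κ τ) (fun α β => Additive.ofMul (g α β)))
    {α β : 𝒰.Index} (x : (𝒰.double α β).carrier) :
    (ofCocycle g hg).toFun α β x = (g α β x : Circle) := dif_pos x.2

end GluingData

namespace LiftedLineBundle

/-- Every cohomology class is the class of a line bundle. -/
theorem exists_hasClass_eq (ξ : equivariantCohomology τ 1 (circleSheaf κ τ)) :
    ∃ L : LiftedLineBundle.{u, v} κ τ, L.HasClass ξ := by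
  obtain ⟨𝒰, g, hg⟩ := RealCover.exists_represents ξ
  have hc : 𝒰.IsInvariantCocycle (F := circleSheaf κ τ)
      (fun α β => Additive.ofMul (Additive.toMul (g α β))) := hg.isInvariantCocycle
  let c := GluingData.ofCocycle (fun α β => Additive.toMul (g α β)) hc
  refine ⟨c.liftedLineBundle, 𝒰, fun α β => Additive.toMul (g α β),
    isTransition_iff.2 ⟨_, c.isFrameSystem_frame, fun α β x => ?_⟩, hg⟩
  exact (c.frame_eq_smul x.2.1 x.2.2).trans
    (congrArg (· • c.frame β (x : M)) (GluingData.ofCocycle_apply hc x))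

/-- Isomorphism classes of line bundles with a lift of the involution are classified by the first
equivariant cohomology group of the sheaf of circle valued functions. -/
theorem exists_classification [FiniteDimensional ℝ E] [IsManifold I ∞ M] [T2Space M]
    [SigmaCompactSpace M] (κ : LiftKind) (τ : SmoothInvolution I M) :
    ∃ c : IsoClasses.{u, v} κ τ ≃ equivariantCohomology τ 1 (circleSheaf κ τ),
      ∀ (L : LiftedLineBundle.{u, v} κ τ) ξ, L.HasClass ξ ↔ c (Quotient.mk _ L) = ξ := by
  choose f hf using fun L : LiftedLineBundle.{u, v} κ τ => L.exists_hasClass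
  let F : IsoClasses.{u, v} κ τ → equivariantCohomology τ 1 (circleSheaf κ τ) :=
    Quotient.lift f fun L L' h => ((hf L).of_isomorphic h).unique (hf L')
  have hF : Function.Bijective F := by
    constructor
    · rintro ⟨L⟩ ⟨L'⟩ (h : f L = f L')
      exact Quotient.sound ((hf L).isomorphic (h ▸ hf L'))
    · intro ξ
      obtain ⟨L, hL⟩ := exists_hasClass_eq.{u, v} ξ
      exact ⟨Quotient.mk _ L, (hf L).unique hL⟩
  refine ⟨Equiv.ofBijective F hF, fun L ξ => ⟨fun h => (hf L).unique h, ?_⟩⟩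
  rintro rfl
  exact hf L

end LiftedLineBundle

end Construction
end RealLine

theorem mainTheorem7 {n : ℕ} {M : Type u} [TopologicalSpace M]
    [ChartedSpace (EuclideanSpace ℝ (Fin n)) M] [IsManifold (𝓡 n) ∞ M]
    [T2Space M] [SecondCountableTopology M]
    (τ : RealLine.SmoothInvolution (𝓡 n) M) :
    -- Real line bundles
    (∃ c : RealLine.LiftedLineBundle.IsoClasses.{u, v} RealLine.LiftKind.antilinear τ ≃
          RealLine.equivariantCohomology τ 1
            (RealLine.circleSheaf RealLine.LiftKind.antilinear τ),
        ∀ (L : RealLine.LiftedLineBundle.{u, v} RealLine.LiftKind.antilinear τ) ξ,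
          L.HasClass ξ ↔ c (Quotient.mk _ L) = ξ) ∧
    -- equivariant line bundles
    (∃ c : RealLine.LiftedLineBundle.IsoClasses.{u, v} RealLine.LiftKind.linear τ ≃
          RealLine.equivariantCohomology τ 1
            (RealLine.circleSheaf RealLine.LiftKind.linear τ),
        ∀ (L : RealLine.LiftedLineBundle.{u, v} RealLine.LiftKind.linear τ) ξ,
          L.HasClass ξ ↔ c (Quotient.mk _ L) = ξ) := by
  -- With second countability this gives the σ-compactness required for partitions of unity.
  have : LocallyCompactSpace M := ChartedSpace.locallyCompactSpace (EuclideanSpace ℝ (Fin n)) M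
  exact ⟨RealLine.LiftedLineBundle.exists_classification RealLine.LiftKind.antilinear τ,
    RealLine.LiftedLineBundle.exists_classification RealLine.LiftKind.linear τ⟩
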